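/- Let $k$ be a commutative artinian ring, let $A$ be an Artin $k$-algebra (a $k$-algebra that is finitely generated as a $k$-module), and let $\operatorname{mod} A$ be the category of left $A$-modules of finite length. An ideal of $\operatorname{mod} A$ is a class $\mathcal I$ of morphisms such that $f+g\in\mathcal I$ for all parallel $f,g\in\mathcal I$, and $\beta f\alpha\in\mathcal I$ for all $f\in\mathcal I$ and all morphisms $\alpha,\beta$ for which the composition is defined. Let $\operatorname{fp}(\operatorname{mod} A,\mathrm{Ab})$ be the abelian category of finitely presented functors, that is, of functors $\operatorname{mod} A\to\mathrm{Ab}$ isomorphic to $\operatorname{coker}\operatorname{Hom}_A(f,-)$ for some morphism $f$ in $\operatorname{mod} A$. Let $\mathcal I$ be an ideal of $\operatorname{mod} A$. (a) $\mathcal I$ is called fp-idempotent if $\{F\in\operatorname{fp}(\operatorname{mod} A,\mathrm{Ab})\mid F(\varphi)=0 \text{ for all }\varphi\in\mathcal I\}$ is a Serre subcategory of $\operatorname{fp}(\operatorname{mod} A,\mathrm{Ab})$, i.e. is closed under subobjects, quotients and extensions. (b) A morphism $f\colon X\to M$ in $\operatorname{mod} A$ is called left $\mathcal I$-factoring (respectively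 strongly left $\mathcal I$-factoring) if for every $\varphi\colon X\to Y$ in $\mathcal I$ there is a morphism $g\colon M\to Y$ (respectively a morphism $g\colon M\to Y$ in $\mathcal I$) with $\varphi=gf$. The ideal $\mathcal I$ is called left idempotent if every left $\mathcal I$-factoring morphism is strongly left $\mathcal I$-factoring. (c) A morphism $f\colon M\to Y$ in $\operatorname{mod} A$ is called right $\mathcal I$-factoring (respectively strongly right $\mathcal I$-factoring) if for every $\varphi\colon X\to Y$ in $\mathcal I$ there is a morphism $g\colon X\to M$ (respectively a morphism $g\colon X\to M$ in $\mathcal I$) with $\varphi=fg$. The ideal $\mathcal I$ is called right idempotent if every right $\mathcal I$-factoring morphism is strongly right $\mathcal I$-factoring. Then $\mathcal I$ is fp-idempotent if and only if it is left idempotent, if and only if it is right idempotent. -/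

import Mathlib

open CategoryTheory Limits Opposite
open scoped ZeroObject

universe u v w

namespace FpIdempotent

section FpFunctors

variable {C : Type w} [Category.{v} C] [Preadditive C]

/-- A functor `F : C ⥤ Ab` is finitely presented if it is isomorphic to `coker Hom(f, -)` for some
morphism `f` of `C`. Such a functor is automatically additive, see `IsFp.iff_elements`. -/
def IsFp : ObjectProperty (C ⥤ AddCommGrpCat.{v}) := fun F =>
  ∃ (X Y : C) (f : X ⟶ Y), Nonempty (F ≅ cokernel (preadditiveCoyoneda.map f.op))

/-- Elementary form of a finite presentation: `F` is additive and there is an element `x` of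
`F X` that generates `F` and whose annihilator is generated by `f : X ⟶ Y`. -/
lemma IsFp.iff_elements (F : C ⥤ AddCommGrpCat.{v}) :
    IsFp F ↔ F.Additive ∧ ∃ (X Y : C) (f : X ⟶ Y) (x : F.obj X),
      (∀ (Z : C) (z : F.obj Z), ∃ a : X ⟶ Z, F.map a x = z) ∧
      (∀ (Z : C) (a : X ⟶ Z), F.map a x = 0 ↔ ∃ y : Y ⟶ Z, f ≫ y = a) := by
  constructor
  · rintro ⟨X, Y, f, ⟨e⟩⟩
    let q : preadditiveCoyoneda.obj (op X) ⟶ F := cokernel.π _ ≫ e.inv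
    have hq : preadditiveCoyoneda.map f.op ≫ q = 0 := by simp [q]
    have hepi : Epi q := epi_comp _ _
    have hS : (ShortComplex.mk _ _ hq).Exact := by
      refine ShortComplex.exact_of_g_is_cokernel _ ?_
      exact IsColimit.ofIsoColimit (cokernelIsCokernel _) (Cofork.ext e.symm (by simp [q]))
    have hsurj : ∀ Z, Function.Surjective (q.app Z) := fun Z =>
      (AddCommGrpCat.epi_iff_surjective _).1 inferInstance
    have hker : ∀ (Z : C) (a : X ⟶ Z), q.app Z a = 0 ↔ ∃ y : Y ⟶ Z, f ≫ y = a := by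
      intro Z a
      have h := hS.map ((evaluation C AddCommGrpCat.{v}).obj Z)
      rw [ShortComplex.ab_exact_iff_function_exact] at h
      exact h a
    have hnat : ∀ (Z : C) (a : X ⟶ Z), F.map a (q.app X (𝟙 X)) = q.app Z a := by
      intro Z a
      have h := ConcreteCategory.congr_hom (q.naturality a) (𝟙 X)
      refine h.symm.trans (congrArg (q.app Z) ?_)
      exact Category.id_comp a
    refine ⟨⟨?_⟩, X, Y, f, q.app X (𝟙 X), ?_, ?_⟩
    · intro U V g h
      ext z
      obtain ⟨a, rfl⟩ := hsurj U z
      have hn : ∀ g : U ⟶ V, F.map g (q.app U a) = q.app V ((a : X ⟶ U) ≫ g) := fun g =>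
        (ConcreteCategory.congr_hom (q.naturality g) a).symm
      have : (F.map g + F.map h) (q.app U a) = F.map g (q.app U a) + F.map h (q.app U a) := rfl
      rw [this, hn, hn, hn]
      refine Eq.trans (congrArg (q.app V) (Preadditive.comp_add X U V a g h)) ?_
      exact map_add (q.app V).hom _ _
    · intro Z z
      obtain ⟨a, rfl⟩ := hsurj Z z
      exact ⟨a, hnat Z a⟩
    · intro Z a
      rw [hnat]
      exact hker Z a
  · rintro ⟨hF, X, Y, f, x, hx, hf⟩
    let q : preadditiveCoyoneda.obj (op X) ⟶ F :=
      { app := fun Z => AddCommGrpCat.ofHom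
          { toFun := fun a : X ⟶ Z => F.map a x
            map_zero' := ConcreteCategory.congr_hom (F.map_zero X Z) x
            map_add' := fun a b =>
              ConcreteCategory.congr_hom (F.map_add (f := (a : X ⟶ Z)) (g := (b : X ⟶ Z))) x }
        naturality := fun Z W g => by
          ext a
          exact ConcreteCategory.congr_hom (F.map_comp (a : X ⟶ Z) g) x }
    have hq : preadditiveCoyoneda.map f.op ≫ q = 0 := by
      ext Z a
      exact (hf Z _).2 ⟨a, rfl⟩
    let π := cokernel.π (preadditiveCoyoneda.map f.op)
    have hfac : ∀ (Z : C) (a : X ⟶ Z), (cokernel.desc _ q hq).app Z (π.app Z a) = F.map a x :=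
      fun Z a => ConcreteCategory.congr_hom
        (congrArg (fun t => NatTrans.app t Z) (cokernel.π_desc _ q hq)) a
    have hzero : ∀ (Z : C) (y : Y ⟶ Z), π.app Z (f ≫ y) = 0 := fun Z y =>
      ConcreteCategory.congr_hom
        (congrArg (fun t => NatTrans.app t Z) (cokernel.condition (preadditiveCoyoneda.map f.op))) y
    have hπ : ∀ Z, Function.Surjective (π.app Z) := fun Z =>
      (AddCommGrpCat.epi_iff_surjective _).1 inferInstance
    have hiso : IsIso (cokernel.desc _ q hq) := by
      rw [NatTrans.isIso_iff_isIso_app]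
      intro Z
      rw [ConcreteCategory.isIso_iff_bijective]
      refine ⟨?_, ?_⟩
      · refine (injective_iff_map_eq_zero ((cokernel.desc _ q hq).app Z).hom).2 ?_
        intro z hz
        obtain ⟨a, rfl⟩ := hπ Z z
        obtain ⟨y, hy⟩ := (hf Z a).1 ((hfac Z a).symm.trans hz)
        exact (congrArg (π.app Z) hy.symm).trans (hzero Z y)
      · intro z
        obtain ⟨a, rfl⟩ := hx Z z
        exact ⟨π.app Z a, hfac Z a⟩
    exact ⟨X, Y, f, ⟨(asIso (cokernel.desc _ q hq)).symm⟩⟩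

instance : (IsFp : ObjectProperty (C ⥤ AddCommGrpCat.{v})).IsClosedUnderIsomorphisms where
  of_iso := fun e ⟨X, Y, f, ⟨e'⟩⟩ => ⟨X, Y, f, ⟨e.symm ≪≫ e'⟩⟩

variable [HasFiniteColimits C]

instance : (IsFp : ObjectProperty (C ⥤ AddCommGrpCat.{v})).ContainsZero where
  exists_zero := by
    refine ⟨0, isZero_zero _, (IsFp.iff_elements _).2 ⟨⟨fun {U V g h} => ?_⟩, ?_⟩⟩
    · exact (((isZero_zero (C ⥤ AddCommGrpCat.{v})).obj U)).eq_of_src _ _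
    · have hsub : ∀ Z, Subsingleton ((0 : C ⥤ AddCommGrpCat.{v}).obj Z) := fun Z =>
        AddCommGrpCat.subsingleton_of_isZero ((isZero_zero (C ⥤ AddCommGrpCat.{v})).obj Z)
      refine ⟨⊥_ C, ⊥_ C, 𝟙 _, 0, fun Z z => ⟨initial.to Z, Subsingleton.elim _ _⟩, fun Z a => ?_⟩
      exact ⟨fun _ => ⟨a, Category.id_comp a⟩, fun _ => Subsingleton.elim _ _⟩

instance : (IsFp : ObjectProperty (C ⥤ AddCommGrpCat.{v})).IsClosedUnderKernels where
  kernels_le := by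
    rintro _ ⟨φ, k, hk, hF, hG⟩
    rename_i F G
    obtain ⟨_, X, Y, f, x, hx, hf⟩ := (IsFp.iff_elements F).1 hF
    obtain ⟨_, U, V, g, u, hu, hg⟩ := (IsFp.iff_elements G).1 hG
    let K := k.pt
    let i : K ⟶ F := k.ι
    have hmono : Mono i := Fork.IsLimit.mono hk
    have hinj : ∀ Z, Function.Injective (i.app Z) := fun Z =>
      (AddCommGrpCat.mono_iff_injective _).1 inferInstance
    have hS : (ShortComplex.mk i φ k.condition).Exact :=
      ShortComplex.exact_of_f_is_kernel _ (IsLimit.ofIsoLimit hk (Fork.ext (Iso.refl _)))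
    have hker : ∀ (Z : C) (z : F.obj Z), φ.app Z z = 0 ↔ ∃ y, i.app Z y = z := by
      intro Z z
      have h := hS.map ((evaluation C AddCommGrpCat.{v}).obj Z)
      rw [ShortComplex.ab_exact_iff_function_exact] at h
      exact h z
    have hi : ∀ {Z W : C} (a : Z ⟶ W) (z : K.obj Z), i.app W (K.map a z) = F.map a (i.app Z z) :=
      fun a z => ConcreteCategory.congr_hom (i.naturality a) z
    have hφ : ∀ {Z W : C} (a : Z ⟶ W) (z : F.obj Z), φ.app W (F.map a z) = G.map a (φ.app Z z) :=
      fun a z => ConcreteCategory.congr_hom (φ.naturality a) z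
    have hc : ∀ (H : C ⥤ AddCommGrpCat.{v}) {Z W T : C} (a : Z ⟶ W) (b : W ⟶ T) (z : H.obj Z),
        H.map (a ≫ b) z = H.map b (H.map a z) :=
      fun H _ _ _ a b z => ConcreteCategory.congr_hom (H.map_comp a b) z
    obtain ⟨α, hα⟩ := hu X (φ.app X x)
    obtain ⟨xK, hxK⟩ := (hker _ (F.map (pushout.inl α g) x)).1 (by
      rw [hφ, ← hα, ← hc, pushout.condition, hg]
      exact ⟨_, rfl⟩)
    have hcalc : ∀ {Z : C} (p : pushout α g ⟶ Z),
        i.app Z (K.map p xK) = F.map (pushout.inl α g ≫ p) x := by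
      intro Z p
      rw [hi, hxK, hc]
    refine (IsFp.iff_elements K).2 ⟨⟨fun {Z W a b} => ?_⟩, pushout α g,
      pushout (pushout.inl α g) f, pushout.inl _ _, xK, fun Z z => ?_, fun Z p => ?_⟩
    · ext z
      apply hinj
      rw [hi, F.map_add]
      refine Eq.trans ?_ (map_add (i.app W).hom (K.map a z) (K.map b z)).symm
      exact congrArg₂ (· + ·) (hi a z).symm (hi b z).symm
    · obtain ⟨a, ha⟩ := hx Z (i.app Z z)
      have h0 : G.map (α ≫ a) u = 0 := by
        rw [hc, hα, ← hφ, ha]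
        exact (hker _ _).2 ⟨_, rfl⟩
      obtain ⟨b, hb⟩ := (hg _ _).1 h0
      refine ⟨pushout.desc a b hb.symm, hinj Z ?_⟩
      rw [hcalc, pushout.inl_desc, ha]
    · rw [← (injective_iff_map_eq_zero' (i.app Z).hom).1 (hinj Z)]
      refine Iff.trans (Eq.congr_left (hcalc p)) ((hf _ _).trans ⟨?_, ?_⟩)
      · rintro ⟨y, hy⟩
        exact ⟨pushout.desc p y hy.symm, pushout.inl_desc _ _ _⟩
      · rintro ⟨q, rfl⟩
        exact ⟨pushout.inr _ _ ≫ q, by rw [← pushout.condition_assoc]⟩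

instance : (IsFp : ObjectProperty (C ⥤ AddCommGrpCat.{v})).IsClosedUnderCokernels where
  cokernels_le := by
    rintro _ ⟨φ, k, hk, hF, hG⟩
    rename_i F G
    have := HasBinaryBiproducts.of_hasBinaryCoproducts (C := C)
    obtain ⟨_, X, Y, f, x, hx, hf⟩ := (IsFp.iff_elements F).1 hF
    obtain ⟨_, U, V, g, u, hu, hg⟩ := (IsFp.iff_elements G).1 hG
    let K := k.pt
    let i : G ⟶ K := k.π
    have hepi : Epi i := Cofork.IsColimit.epi hk
    have hsurj : ∀ Z, Function.Surjective (i.app Z) := fun Z =>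
      (AddCommGrpCat.epi_iff_surjective _).1 inferInstance
    have hS : (ShortComplex.mk φ i k.condition).Exact :=
      ShortComplex.exact_of_g_is_cokernel _ (IsColimit.ofIsoColimit hk (Cofork.ext (Iso.refl _)))
    have hker : ∀ (Z : C) (z : G.obj Z), i.app Z z = 0 ↔ ∃ y, φ.app Z y = z := by
      intro Z z
      have h := hS.map ((evaluation C AddCommGrpCat.{v}).obj Z)
      rw [ShortComplex.ab_exact_iff_function_exact] at h
      exact h z
    have hi : ∀ {Z W : C} (a : Z ⟶ W) (z : G.obj Z), i.app W (G.map a z) = K.map a (i.app Z z) :=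
      fun a z => ConcreteCategory.congr_hom (i.naturality a) z
    have hφ : ∀ {Z W : C} (a : Z ⟶ W) (z : F.obj Z), φ.app W (F.map a z) = G.map a (φ.app Z z) :=
      fun a z => ConcreteCategory.congr_hom (φ.naturality a) z
    have hc : ∀ (H : C ⥤ AddCommGrpCat.{v}) {Z W T : C} (a : Z ⟶ W) (b : W ⟶ T) (z : H.obj Z),
        H.map (a ≫ b) z = H.map b (H.map a z) :=
      fun H _ _ _ a b z => ConcreteCategory.congr_hom (H.map_comp a b) z
    have hadd : ∀ {Z W : C} (a b : Z ⟶ W) (z : G.obj Z),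
        G.map (a + b) z = G.map a z + G.map b z :=
      fun a b z => ConcreteCategory.congr_hom (G.map_add (f := a) (g := b)) z
    obtain ⟨α, hα⟩ := hu X (φ.app X x)
    refine (IsFp.iff_elements K).2 ⟨⟨fun {Z W a b} => ?_⟩, U, V ⊞ X, biprod.lift g α,
      i.app U u, fun Z z => ?_, fun Z p => ?_⟩
    · ext z
      obtain ⟨z, rfl⟩ := hsurj _ z
      rw [← hi, hadd]
      refine Eq.trans (map_add (i.app W).hom (G.map a z) (G.map b z)) ?_
      exact congrArg₂ (· + ·) (hi a z) (hi b z)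
    · obtain ⟨z, rfl⟩ := hsurj _ z
      obtain ⟨a, rfl⟩ := hu Z z
      exact ⟨a, (hi _ _).symm⟩
    · rw [← hi, hker]
      constructor
      · rintro ⟨y, hy⟩
        obtain ⟨b, rfl⟩ := hx Z y
        rw [hφ, ← hα, ← hc] at hy
        have h0 : G.map (p - α ≫ b) u = 0 := by
          have := hadd (p - α ≫ b) (α ≫ b) u
          rw [sub_add_cancel, hy] at this
          exact right_eq_add.1 this
        obtain ⟨y, hy⟩ := (hg _ _).1 h0
        exact ⟨biprod.desc y b, by rw [biprod.lift_desc, hy, sub_add_cancel]⟩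
      · rintro ⟨y, rfl⟩
        refine ⟨F.map (biprod.inr ≫ y) x, ?_⟩
        have h0 : G.map (g ≫ biprod.inl ≫ y) u = 0 := (hg _ _).2 ⟨_, rfl⟩
        have h1 : biprod.lift g α ≫ y = g ≫ biprod.inl ≫ y + α ≫ biprod.inr ≫ y := by
          rw [biprod.lift_eq, Preadditive.add_comp, Category.assoc, Category.assoc]
        rw [hφ, ← hα, ← hc, h1, hadd, h0, zero_add]

lemma IsFp.biprod {F G : C ⥤ AddCommGrpCat.{v}} (hF : IsFp F) (hG : IsFp G) : IsFp (F ⊞ G) := by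
  have := HasBinaryBiproducts.of_hasBinaryCoproducts (C := C)
  obtain ⟨_, X, Y, f, x, hx, hf⟩ := (IsFp.iff_elements F).1 hF
  obtain ⟨_, U, V, g, u, hu, hg⟩ := (IsFp.iff_elements G).1 hG
  let B := F ⊞ G
  have h11 : ∀ (Z : C) (z : F.obj Z),
      (biprod.fst : B ⟶ F).app Z ((biprod.inl : F ⟶ B).app Z z) = z := fun Z z =>
    ConcreteCategory.congr_hom
      (congrArg (fun t => NatTrans.app t Z) (biprod.inl_fst (X := F) (Y := G))) z
  have h12 : ∀ (Z : C) (z : F.obj Z),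
      (biprod.snd : B ⟶ G).app Z ((biprod.inl : F ⟶ B).app Z z) = 0 := fun Z z =>
    ConcreteCategory.congr_hom
      (congrArg (fun t => NatTrans.app t Z) (biprod.inl_snd (X := F) (Y := G))) z
  have h21 : ∀ (Z : C) (z : G.obj Z),
      (biprod.fst : B ⟶ F).app Z ((biprod.inr : G ⟶ B).app Z z) = 0 := fun Z z =>
    ConcreteCategory.congr_hom
      (congrArg (fun t => NatTrans.app t Z) (biprod.inr_fst (X := F) (Y := G))) z
  have h22 : ∀ (Z : C) (z : G.obj Z),
      (biprod.snd : B ⟶ G).app Z ((biprod.inr : G ⟶ B).app Z z) = z := fun Z z =>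
    ConcreteCategory.congr_hom
      (congrArg (fun t => NatTrans.app t Z) (biprod.inr_snd (X := F) (Y := G))) z
  have htot : ∀ (Z : C) (z : B.obj Z), (biprod.inl : F ⟶ B).app Z ((biprod.fst : B ⟶ F).app Z z) +
      (biprod.inr : G ⟶ B).app Z ((biprod.snd : B ⟶ G).app Z z) = z := fun Z z =>
    ConcreteCategory.congr_hom
      (congrArg (fun t => NatTrans.app t Z) (biprod.total (X := F) (Y := G))) z
  have hc : ∀ (H : C ⥤ AddCommGrpCat.{v}) {Z W T : C} (a : Z ⟶ W) (b : W ⟶ T) (z : H.obj Z),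
      H.map (a ≫ b) z = H.map b (H.map a z) :=
    fun H _ _ _ a b z => ConcreteCategory.congr_hom (H.map_comp a b) z
  have hn : ∀ {H H' : C ⥤ AddCommGrpCat.{v}} (t : H ⟶ H') {Z W : C} (a : Z ⟶ W) (z : H.obj Z),
      t.app W (H.map a z) = H'.map a (t.app Z z) :=
    fun t _ _ a z => ConcreteCategory.congr_hom (t.naturality a) z
  have hext : ∀ {Z : C} (z z' : B.obj Z),
      (biprod.fst : B ⟶ F).app Z z = (biprod.fst : B ⟶ F).app Z z' →
      (biprod.snd : B ⟶ G).app Z z = (biprod.snd : B ⟶ G).app Z z' → z = z' := by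
    intro Z z z' h h'
    rw [← htot Z z, ← htot Z z', h, h']
  let t : B.obj (X ⊞ U) := (biprod.inl : F ⟶ B).app _ (F.map biprod.inl x) +
    (biprod.inr : G ⟶ B).app _ (G.map biprod.inr u)
  have ht1 : ∀ {Z : C} (a : X ⊞ U ⟶ Z),
      (biprod.fst : B ⟶ F).app Z (B.map a t) = F.map (biprod.inl ≫ a) x := by
    intro Z a
    rw [hn, map_add, h11, h21, add_zero, hc]
  have ht2 : ∀ {Z : C} (a : X ⊞ U ⟶ Z),
      (biprod.snd : B ⟶ G).app Z (B.map a t) = G.map (biprod.inr ≫ a) u := by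
    intro Z a
    rw [hn, map_add, h12, h22, zero_add, hc]
  refine (IsFp.iff_elements B).2 ⟨⟨fun {Z W a b} => ?_⟩, X ⊞ U, Y ⊞ V, biprod.map f g, t,
    fun Z z => ?_, fun Z a => ?_⟩
  · ext z
    have hs : (B.map a + B.map b) z = B.map a z + B.map b z := rfl
    refine hext _ _ ?_ ?_
    · rw [hs, map_add, hn, hn, hn, F.map_add]
      rfl
    · rw [hs, map_add, hn, hn, hn, G.map_add]
      rfl
  · obtain ⟨a, ha⟩ := hx Z ((biprod.fst : B ⟶ F).app Z z)
    obtain ⟨b, hb⟩ := hu Z ((biprod.snd : B ⟶ G).app Z z)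
    refine ⟨biprod.desc a b, hext _ _ ?_ ?_⟩
    · rw [ht1, biprod.inl_desc, ha]
    · rw [ht2, biprod.inr_desc, hb]
  · constructor
    · intro h
      obtain ⟨y, hy⟩ := (hf Z (biprod.inl ≫ a)).1 (by rw [← ht1, h, map_zero])
      obtain ⟨y', hy'⟩ := (hg Z (biprod.inr ≫ a)).1 (by rw [← ht2, h, map_zero])
      refine ⟨biprod.desc y y', ?_⟩
      ext
      · rw [biprod.inl_map_assoc, biprod.inl_desc, hy]
      · rw [biprod.inr_map_assoc, biprod.inr_desc, hy']
    · rintro ⟨y, rfl⟩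
      refine hext _ _ ?_ ?_
      · rw [ht1, map_zero]
        exact (hf _ _).2 ⟨biprod.inl ≫ y, by rw [biprod.inl_map_assoc]⟩
      · rw [ht2, map_zero]
        exact (hg _ _).2 ⟨biprod.inr ≫ y, by rw [biprod.inr_map_assoc]⟩

instance : (IsFp : ObjectProperty (C ⥤ AddCommGrpCat.{v})).IsClosedUnderFiniteProducts := by
  have : (IsFp : ObjectProperty (C ⥤ AddCommGrpCat.{v})).IsClosedUnderBinaryProducts := by
    refine ⟨?_⟩
    rintro F ⟨p⟩
    refine ObjectProperty.prop_of_iso _ ?_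
      (IsFp.biprod (p.prop_diag_obj ⟨WalkingPair.left⟩) (p.prop_diag_obj ⟨WalkingPair.right⟩))
    exact (biprod.isoProd _ _).trans
      ((HasLimit.isoOfNatIso (diagramIsoPair p.diag)).symm.trans
        (IsLimit.conePointUniqueUpToIso (limit.isLimit _) p.isLimit))
  exact ObjectProperty.IsClosedUnderFiniteProducts.mk'

/-- The category `fp(C, Ab)` of finitely presented functors `C ⥤ Ab`. By the closure properties
above it is an abelian category, with kernels and cokernels computed in the functor category. -/
abbrev FpFunctor (C : Type w) [Category.{v} C] [Preadditive C] : Type (max v w (v + 1)) :=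
  (IsFp : ObjectProperty (C ⥤ AddCommGrpCat.{v})).FullSubcategory

end FpFunctors

section Ideals

variable {C : Type w} [Category.{v} C] [Preadditive C]

/-- A class of morphisms is an ideal if it is closed under sums of parallel morphisms and under
composition with arbitrary morphisms on both sides. -/
structure IsIdeal (I : MorphismProperty C) : Prop where
  add_mem : ∀ {X Y : C} (f g : X ⟶ Y), I f → I g → I (f + g)
  comp_mem : ∀ {W X Y Z : C} (α : W ⟶ X) (f : X ⟶ Y) (β : Y ⟶ Z), I f → I (α ≫ f ≫ β)

/-- The finitely presented functors that vanish on all morphisms of `I`. -/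
def annihilator (I : MorphismProperty C) : ObjectProperty (FpFunctor C) := fun F =>
  ∀ ⦃X Y : C⦄ (f : X ⟶ Y), I f → F.obj.map f = 0

/-- `I` is fp-idempotent if the functors in `fp(C, Ab)` vanishing on `I` form a Serre subcategory
of the abelian category `fp(C, Ab)`. -/
def IsFpIdempotent [HasFiniteColimits C] (I : MorphismProperty C) : Prop :=
  (annihilator I).IsSerreClass

/-- `f : X ⟶ M` is left `I`-factoring if every morphism of `I` starting in `X` factors
through `f`. -/
def IsLeftFactoring (I : MorphismProperty C) {X M : C} (f : X ⟶ M) : Prop :=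
  ∀ ⦃Y : C⦄ (φ : X ⟶ Y), I φ → ∃ g : M ⟶ Y, f ≫ g = φ

/-- `f : X ⟶ M` is strongly left `I`-factoring if every morphism of `I` starting in `X` factors
through `f` by a morphism of `I`. -/
def IsStronglyLeftFactoring (I : MorphismProperty C) {X M : C} (f : X ⟶ M) : Prop :=
  ∀ ⦃Y : C⦄ (φ : X ⟶ Y), I φ → ∃ g : M ⟶ Y, I g ∧ f ≫ g = φ

/-- `f : M ⟶ Y` is right `I`-factoring if every morphism of `I` ending in `Y` factors
through `f`. -/
def IsRightFactoring (I : MorphismProperty C) {M Y : C} (f : M ⟶ Y) : Prop :=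
  ∀ ⦃X : C⦄ (φ : X ⟶ Y), I φ → ∃ g : X ⟶ M, g ≫ f = φ

/-- `f : M ⟶ Y` is strongly right `I`-factoring if every morphism of `I` ending in `Y` factors
through `f` by a morphism of `I`. -/
def IsStronglyRightFactoring (I : MorphismProperty C) {M Y : C} (f : M ⟶ Y) : Prop :=
  ∀ ⦃X : C⦄ (φ : X ⟶ Y), I φ → ∃ g : X ⟶ M, I g ∧ g ≫ f = φ

/-- Every left `I`-factoring morphism is strongly left `I`-factoring. -/
def IsLeftIdempotent (I : MorphismProperty C) : Prop :=
  ∀ ⦃X M : C⦄ (f : X ⟶ M), IsLeftFactoring I f → IsStronglyLeftFactoring I f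

/-- Every right `I`-factoring morphism is strongly right `I`-factoring. -/
def IsRightIdempotent (I : MorphismProperty C) : Prop :=
  ∀ ⦃M Y : C⦄ (f : M ⟶ Y), IsRightFactoring I f → IsStronglyRightFactoring I f

end Ideals

/-- Over an Artin algebra `A` the finitely generated modules are the modules of finite length, so
that `FGModuleCat A` is the category `mod A` of left `A`-modules of finite length. -/
lemma finite_iff_isFiniteLength (k A M : Type*) [CommRing k] [IsArtinianRing k] [Ring A]
    [Algebra k A] [Module.Finite k A] [AddCommGroup M] [Module A M] :
    Module.Finite A M ↔ IsFiniteLength A M := by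
  have : IsArtinianRing A := IsArtinianRing.of_finite k A
  rw [isFiniteLength_iff_isNoetherian_isArtinian]
  exact ⟨fun _ => ⟨inferInstance, inferInstance⟩, fun ⟨_, _⟩ => inferInstance⟩

end FpIdempotent

/-! By Yoneda, `coker Hom(f, -)` vanishes on `I` exactly when `f` is left `I`-factoring
(`annihilator_cokerHom_iff`), so fp-idempotence is a statement about factorizations. Vanishing on
`I` always passes to subobjects and quotients, because these are computed pointwise; only extensions
matter.

If `I` is left idempotent, the generator and relation of the middle term of an extension, together
with the generator of the subobject, produce a left `I`-factoring morphism. Factoring through it by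
a morphism of `I` kills the middle term on `I` (`IsLeftIdempotent.annihilator_of_shortExact`).

The other implications use the duality `D = Hom_k(-, E)`, where `E` is an injective cogenerator over
`k` with Matlis duality (`exists_isDualizing`, `IsDualizing.eval_surjective`). If a strong
factorization of `φ` fails, some functional `ξ` kills all the strongly factoring morphisms but not
`φ`. As `D Hom(-, Y)` is finitely presented (`IsDualizing.hasFpDuals`), the vanishing of such
functionals becomes factorization through a pushout. That pushout map is left `I`-factoring, and the
hypothesis on `I` then forces `ξ φ = 0`. Fp-idempotence enters as closure of left `I`-factoring
morphisms under composition. The passage from right to left idempotence is the passage from left to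
right in the opposite category, where `D Hom(X, -)` must be finitely presented
(`IsDualizing.hasFpDuals_op`). -/

namespace FpIdempotent

/-! ### Ideals, opposite categories and pushouts -/

section Factoring

variable {C : Type w} [Category.{v} C]

section Ideal

variable [Preadditive C]

lemma IsIdeal.precomp {I : MorphismProperty C} (hI : IsIdeal I) {W X Y : C} (α : W ⟶ X)
    {f : X ⟶ Y} (hf : I f) : I (α ≫ f) := by
  simpa using hI.comp_mem α f (𝟙 Y) hf

lemma IsIdeal.postcomp {I : MorphismProperty C} (hI : IsIdeal I) {X Y Z : C} {f : X ⟶ Y}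
    (hf : I f) (β : Y ⟶ Z) : I (f ≫ β) := by
  simpa using hI.comp_mem (𝟙 X) f β hf

lemma IsIdeal.op {I : MorphismProperty C} (hI : IsIdeal I) : IsIdeal I.op where
  add_mem f g hf hg := hI.add_mem f.unop g.unop hf hg
  comp_mem α f β hf := by
    have h := hI.comp_mem β.unop f.unop α.unop hf
    rwa [← Category.assoc] at h

end Ideal

lemma isLeftIdempotent_op_iff (I : MorphismProperty C) :
    IsLeftIdempotent I.op ↔ IsRightIdempotent I := by
  constructor
  · intro h M Y f hf X φ hφ
    obtain ⟨g, hg, e⟩ := h f.op (fun Z ψ hψ => by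
      obtain ⟨g, hg⟩ := hf ψ.unop hψ
      exact ⟨g.op, Quiver.Hom.unop_inj hg⟩) φ.op hφ
    exact ⟨g.unop, hg, Quiver.Hom.op_inj e⟩
  · intro h X M f hf Y φ hφ
    obtain ⟨g, hg, e⟩ := h f.unop (fun Z ψ hψ => by
      obtain ⟨g, hg⟩ := hf ψ.op hψ
      exact ⟨g.unop, Quiver.Hom.op_inj hg⟩) φ.unop hφ
    exact ⟨g.op, hg, Quiver.Hom.unop_inj e⟩

lemma isRightIdempotent_op_iff (I : MorphismProperty C) :
    IsRightIdempotent I.op ↔ IsLeftIdempotent I := by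
  constructor
  · intro h X M f hf Y φ hφ
    obtain ⟨g, hg, e⟩ := h f.op (fun Z ψ hψ => by
      obtain ⟨g, hg⟩ := hf ψ.unop hψ
      exact ⟨g.op, Quiver.Hom.unop_inj hg⟩) φ.op hφ
    exact ⟨g.unop, hg, Quiver.Hom.op_inj e⟩
  · intro h M Y f hf X φ hφ
    obtain ⟨g, hg, e⟩ := h f.unop (fun Z ψ hψ => by
      obtain ⟨g, hg⟩ := hf ψ.op hψ
      exact ⟨g.unop, Quiver.Hom.op_inj hg⟩) φ.unop hφ
    exact ⟨g.op, hg, Quiver.Hom.unop_inj e⟩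

/-- A morphism `u` factors through the pushout of `s` along `a` iff `a ≫ u` factors through `s`. -/
lemma exists_factor_pushout_inl_iff [HasPushouts C] {P Q X Z : C} (a : P ⟶ X) (s : P ⟶ Q)
    (u : X ⟶ Z) : (∃ v, pushout.inl a s ≫ v = u) ↔ ∃ b, s ≫ b = a ≫ u := by
  constructor
  · rintro ⟨v, rfl⟩
    exact ⟨pushout.inr a s ≫ v, by rw [pushout.condition_assoc]⟩
  · rintro ⟨b, hb⟩
    exact ⟨pushout.desc u b hb.symm, pushout.inl_desc _ _ _⟩

end Factoring

/-! ### Finitely presented functors vanishing on an ideal -/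

section Functors

variable {C : Type w} [Category.{v} C] [Preadditive C]

lemma cokernel_coyoneda_π_surjective {X Y : C} (f : X ⟶ Y) (Z : C) :
    Function.Surjective ((cokernel.π (preadditiveCoyoneda.map f.op)).app Z) :=
  (AddCommGrpCat.epi_iff_surjective _).1 inferInstance

lemma cokernel_coyoneda_π_eq_zero_iff {X Y : C} (f : X ⟶ Y) {Z : C} (a : X ⟶ Z) :
    (cokernel.π (preadditiveCoyoneda.map f.op)).app Z a = 0 ↔ ∃ y : Y ⟶ Z, f ≫ y = a := by
  have hS := ShortComplex.exact_cokernel (preadditiveCoyoneda.map f.op)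
  have h := hS.map ((evaluation C AddCommGrpCat.{v}).obj Z)
  rw [ShortComplex.ab_exact_iff_function_exact] at h
  exact h a

/-- The finitely presented functor `coker Hom(f, -)`. -/
noncomputable def cokerHom {X Y : C} (f : X ⟶ Y) : FpFunctor C :=
  ⟨cokernel (preadditiveCoyoneda.map f.op), X, Y, f, ⟨Iso.refl _⟩⟩

/-- The class of the identity of `X` generates the functor, and a morphism `φ` starting in `X` sends
it to the class of `φ`, which is zero iff `φ` factors through `f`. -/
lemma annihilator_cokerHom_iff {I : MorphismProperty C} (hI : IsIdeal I) {X Y : C} (f : X ⟶ Y) :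
    annihilator I (cokerHom f) ↔ IsLeftFactoring I f := by
  have hn : ∀ {Z W : C} (a : X ⟶ Z) (φ : Z ⟶ W),
      (cokernel (preadditiveCoyoneda.map f.op)).map φ
        ((cokernel.π (preadditiveCoyoneda.map f.op)).app Z a) =
      (cokernel.π (preadditiveCoyoneda.map f.op)).app W (a ≫ φ) := fun a φ =>
    (ConcreteCategory.congr_hom ((cokernel.π (preadditiveCoyoneda.map f.op)).naturality φ) a).symm
  constructor
  · intro h Z φ hφ
    rw [← cokernel_coyoneda_π_eq_zero_iff]
    have h1 := hn (𝟙 X) φ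
    rw [Category.id_comp] at h1
    rw [← h1]
    exact ConcreteCategory.congr_hom (h φ hφ) _
  · intro h Z W φ hφ
    refine ConcreteCategory.hom_ext _ _ fun z => ?_
    obtain ⟨a, rfl⟩ := cokernel_coyoneda_π_surjective f Z z
    exact (hn a φ).trans ((cokernel_coyoneda_π_eq_zero_iff f _).2 (h _ (hI.precomp a hφ)))

lemma FpFunctor.naturality_apply {F G : FpFunctor C} (t : F ⟶ G) {Z W : C} (a : Z ⟶ W)
    (z : F.obj.obj Z) : t.hom.app W (F.obj.map a z) = G.obj.map a (t.hom.app Z z) :=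
  ConcreteCategory.congr_hom (t.hom.naturality a) z

variable [HasFiniteColimits C]

lemma FpFunctor.app_injective_of_mono {F G : FpFunctor C} (i : F ⟶ G) [Mono i] (Z : C) :
    Function.Injective (i.hom.app Z) := by
  have :=
    (IsFp : ObjectProperty (C ⥤ AddCommGrpCat.{v})).preservesMonomorphisms_ι_of_isNormalEpiCategory
  have : Mono i.hom := inferInstanceAs (Mono (ObjectProperty.ι _ |>.map i))
  exact (AddCommGrpCat.mono_iff_injective _).1 inferInstance

lemma FpFunctor.app_surjective_of_epi {F G : FpFunctor C} (p : F ⟶ G) [Epi p] (Z : C) :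
    Function.Surjective (p.hom.app Z) := by
  have :=
    (IsFp : ObjectProperty (C ⥤ AddCommGrpCat.{v})).preservesEpimorphisms_ι_of_isNormalMonoCategory
  have : Epi p.hom := inferInstanceAs (Epi (ObjectProperty.ι _ |>.map p))
  exact (AddCommGrpCat.epi_iff_surjective _).1 inferInstance

lemma FpFunctor.exists_app_eq_of_shortExact {S : ShortComplex (FpFunctor C)} (hS : S.ShortExact)
    {Z : C} (z : S.X₂.obj.obj Z) (hz : S.g.hom.app Z z = 0) : ∃ y, S.f.hom.app Z y = z := by
  have :=
    (IsFp : ObjectProperty (C ⥤ AddCommGrpCat.{v})).preservesKernels_ι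
  have hk := KernelFork.mapIsLimit _ hS.fIsKernel (ObjectProperty.ι _)
  have h := ShortComplex.exact_of_f_is_kernel (S.map (ObjectProperty.ι _)) hk
  have h := h.map ((evaluation C AddCommGrpCat.{v}).obj Z)
  rw [ShortComplex.ab_exact_iff_function_exact] at h
  exact (h z).1 hz

lemma annihilator_of_mono {I : MorphismProperty C} {F G : FpFunctor C} (i : F ⟶ G) [Mono i]
    (hG : annihilator I G) : annihilator I F := by
  intro Z W φ hφ
  refine ConcreteCategory.hom_ext _ _ fun z => ?_
  apply FpFunctor.app_injective_of_mono i
  rw [FpFunctor.naturality_apply, hG φ hφ]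
  exact (map_zero (i.hom.app W).hom).symm

lemma annihilator_of_epi {I : MorphismProperty C} {F G : FpFunctor C} (p : F ⟶ G) [Epi p]
    (hF : annihilator I F) : annihilator I G := by
  intro Z W φ hφ
  refine ConcreteCategory.hom_ext _ _ fun z => ?_
  obtain ⟨z, rfl⟩ := FpFunctor.app_surjective_of_epi p Z z
  rw [← FpFunctor.naturality_apply, hF φ hφ]
  exact map_zero (p.hom.app W).hom

/-- The quotient `S.X₃` is presented by `(f, α)`, where `f` presents `S.X₂` and `α` takes its
generator `x` to the image of the generator `y` of `S.X₁`. If a morphism of `I` factors through `(f,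
α)` by some `t` in `I`, then on `x` the component through `f` vanishes by the relation, and the
component through `α` is the image of a value of `S.X₁` on a morphism of `I`. -/
lemma IsLeftIdempotent.annihilator_of_shortExact {I : MorphismProperty C} (hI : IsIdeal I)
    (h : IsLeftIdempotent I) {S : ShortComplex (FpFunctor C)} (hS : S.ShortExact)
    (h₁ : annihilator I S.X₁) (h₃ : annihilator I S.X₃) : annihilator I S.X₂ := by
  have := HasBinaryBiproducts.of_hasBinaryCoproducts (C := C)
  obtain ⟨_, U, V, g, y, hy, hg⟩ := (IsFp.iff_elements _).1 S.X₁.property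
  obtain ⟨_, X, M, f, x, hx, hf⟩ := (IsFp.iff_elements _).1 S.X₂.property
  have hc : ∀ {Z W T : C} (a : Z ⟶ W) (b : W ⟶ T) (z : S.X₂.obj.obj Z),
      S.X₂.obj.map (a ≫ b) z = S.X₂.obj.map b (S.X₂.obj.map a z) :=
    fun a b z => ConcreteCategory.congr_hom (S.X₂.obj.map_comp a b) z
  have hadd : ∀ {Z W : C} (a b : Z ⟶ W) (z : S.X₂.obj.obj Z),
      S.X₂.obj.map (a + b) z = S.X₂.obj.map a z + S.X₂.obj.map b z :=
    fun a b z => ConcreteCategory.congr_hom (S.X₂.obj.map_add (f := a) (g := b)) z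
  obtain ⟨α, hα⟩ := hx U (S.f.hom.app U y)
  -- For `φ` in `I`, the element `φ x` dies in `S.X₃`, so it comes from some `b y`; then `φ - α ≫ b`
  -- kills `x` and factors through `f`.
  have hfac : IsLeftFactoring I (biprod.lift f α) := by
    intro Y φ hφ
    obtain ⟨y', hy'⟩ := FpFunctor.exists_app_eq_of_shortExact hS (S.X₂.obj.map φ x) (by
      rw [FpFunctor.naturality_apply, h₃ φ hφ]; rfl)
    obtain ⟨b, rfl⟩ := hy Y y'
    rw [FpFunctor.naturality_apply, ← hα, ← hc] at hy'
    obtain ⟨c, hc'⟩ := (hf Y (φ - α ≫ b)).1 (by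
      have h0 := hadd (φ - α ≫ b) (α ≫ b) x
      rw [sub_add_cancel, hy'] at h0
      exact right_eq_add.1 h0)
    exact ⟨biprod.desc c b, by rw [biprod.lift_desc, hc', sub_add_cancel]⟩
  intro Z W φ hφ
  refine ConcreteCategory.hom_ext _ _ fun z => ?_
  obtain ⟨a, rfl⟩ := hx Z z
  obtain ⟨t, ht, e⟩ := h _ hfac (a ≫ φ) (hI.precomp a hφ)
  have h0 : S.X₂.obj.map (f ≫ biprod.inl ≫ t) x = 0 := (hf _ _).2 ⟨_, rfl⟩
  rw [← hc, ← e, biprod.lift_eq, Preadditive.add_comp, Category.assoc, Category.assoc, hadd, h0,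
    zero_add, hc, hα, ← FpFunctor.naturality_apply, h₁ _ (hI.precomp biprod.inr ht)]
  exact map_zero (S.f.hom.app W).hom

lemma IsLeftIdempotent.isFpIdempotent {I : MorphismProperty C} (hI : IsIdeal I)
    (h : IsLeftIdempotent I) : IsFpIdempotent I :=
  { exists_zero := ⟨0, isZero_zero _, fun X Y f _ => by
      have hz : IsZero (ObjectProperty.ι (IsFp (C := C)) |>.obj 0) :=
        Functor.map_isZero _ (isZero_zero _)
      exact (hz.obj X).eq_of_src _ _⟩
    prop_of_mono := fun i _ hG => annihilator_of_mono i hG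
    prop_of_epi := fun p _ hF => annihilator_of_epi p hF
    prop_X₂_of_shortExact := fun hS h₁ h₃ => h.annihilator_of_shortExact hI hS h₁ h₃ }

/-- The kernel of `coker Hom(f ≫ g, -) ⟶ coker Hom(f, -)` consists of classes of morphisms `f ≫ u`,
hence is a quotient of `coker Hom(g, -)` and vanishes on `I`. The Serre property transfers the
vanishing to the middle term. -/
lemma IsFpIdempotent.isLeftFactoring_comp {I : MorphismProperty C} (hI : IsIdeal I)
    (h : IsFpIdempotent I) {X M N : C} {f : X ⟶ M} {g : M ⟶ N} (hf : IsLeftFactoring I f)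
    (hg : IsLeftFactoring I g) : IsLeftFactoring I (f ≫ g) := by
  have : (annihilator I).IsSerreClass := h
  rw [← annihilator_cokerHom_iff hI] at hf ⊢
  have hw : preadditiveCoyoneda.map (f ≫ g).op ≫
      cokernel.π (preadditiveCoyoneda.map f.op) = 0 := by
    rw [op_comp, Functor.map_comp, Category.assoc, cokernel.condition, comp_zero]
  let t : cokerHom (f ≫ g) ⟶ cokerHom f := ObjectProperty.homMk (cokernel.desc _ _ hw)
  have ht : ∀ (Z : C) (a : X ⟶ Z),
      t.hom.app Z ((cokernel.π (preadditiveCoyoneda.map (f ≫ g).op)).app Z a) =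
        (cokernel.π (preadditiveCoyoneda.map f.op)).app Z a := fun Z a =>
    ConcreteCategory.congr_hom
      (congrArg (fun t => NatTrans.app t Z) (cokernel.π_desc _ _ hw)) a
  have hS : (ShortComplex.mk (kernel.ι t) t (kernel.condition t)).Exact :=
    ShortComplex.exact_kernel t
  refine (annihilator I).prop_X₂_of_exact hS ?_ hf
  intro Z W φ hφ
  refine ConcreteCategory.hom_ext _ _ fun z => ?_
  apply FpFunctor.app_injective_of_mono (kernel.ι t)
  rw [FpFunctor.naturality_apply]
  obtain ⟨a, ha⟩ := cokernel_coyoneda_π_surjective (f ≫ g) Z ((kernel.ι t).hom.app Z z)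
  have h0 : t.hom.app Z ((kernel.ι t).hom.app Z z) = 0 :=
    ConcreteCategory.congr_hom (congrArg (fun s => NatTrans.app s.hom Z) (kernel.condition t)) z
  obtain ⟨u, rfl⟩ := (cokernel_coyoneda_π_eq_zero_iff f a).1
    ((ht Z a).symm.trans ((congrArg _ ha).trans h0))
  rw [← ha]
  obtain ⟨v, hv⟩ := hg _ (hI.precomp u hφ)
  refine (ConcreteCategory.congr_hom
    ((cokernel.π (preadditiveCoyoneda.map (f ≫ g).op)).naturality φ) (f ≫ u : X ⟶ Z)).symm.trans ?_
  refine ((cokernel_coyoneda_π_eq_zero_iff (f ≫ g) _).2 ⟨v, ?_⟩).trans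
    (map_zero ((kernel.ι t).hom.app W).hom).symm
  rw [Category.assoc, hv]
  exact (Category.assoc _ _ _).symm

end Functors

/-! ### Matlis duality over a commutative ring -/

section Matlis

variable {R : Type u} [CommRing R]

/-- The submodules whose `m`-torsion is at most one copy of `R ⧸ m`, for all maximal ideals `m`. -/
def HasThinSocle {J : Type v} [AddCommGroup J] [Module R J] (E : Submodule R J) : Prop :=
  ∀ (m : Ideal R), m.IsMaximal → ∀ x ∈ E, ∀ y ∈ E, (∀ r ∈ m, r • x = 0) → (∀ r ∈ m, r • y = 0) →
    x ≠ 0 → ∃ c : R, c • x = y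

/-- The condition involves only two elements at a time, so it survives unions of chains. -/
lemma exists_maximal_hasThinSocle (R : Type u) [CommRing R] (J : Type v) [AddCommGroup J]
    [Module R J] : ∃ E : Submodule R J, Maximal HasThinSocle E := by
  refine zorn_le₀ {E | HasThinSocle E} fun c hc hchain => ?_
  rcases c.eq_empty_or_nonempty with rfl | hne
  · refine ⟨⊥, ?_, by simp⟩
    rintro m - x hx - - - - h0
    exact absurd ((Submodule.mem_bot R).1 hx) h0
  · refine ⟨sSup c, ?_, fun E hE => le_sSup hE⟩
    intro m hm x hx y hy hmx hmy h0
    have hd : DirectedOn (· ≤ ·) c := hchain.directedOn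
    obtain ⟨E, hE, hxE⟩ := (Submodule.mem_sSup_of_directed hne hd).1 hx
    obtain ⟨F, hF, hyF⟩ := (Submodule.mem_sSup_of_directed hne hd).1 hy
    obtain ⟨G, hG, hEG, hFG⟩ := hd E hE F hF
    exact hc hG m hm x (hEG hxE) y (hFG hyF) hmx hmy h0

/-- A maximal submodule with thin socle contains a copy of every simple module that embeds into
the ambient module. -/
lemma exists_ne_zero_of_maximal_hasThinSocle {J : Type v} [AddCommGroup J] [Module R J]
    {E : Submodule R J} (hE : Maximal HasThinSocle E) (m : Ideal R) [hm : m.IsMaximal] {x : J}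
    (hx0 : x ≠ 0) (hx : ∀ r ∈ m, r • x = 0) : ∃ y ∈ E, y ≠ 0 ∧ ∀ r ∈ m, r • y = 0 := by
  -- Otherwise `E ⊔ R ∙ x` still has thin socle: torsion at other maximal ideals already lies in `E`
  -- by coprimality, and `m`-torsion lies in `R ∙ x`. Maximality then puts `x` into `E`.
  by_contra! hcon
  have hzero : ∀ y ∈ E, (∀ r ∈ m, r • y = 0) → y = 0 := fun y hy h => by
    by_contra h0
    obtain ⟨r, hr, hr'⟩ := hcon y hy h0
    exact hr' (h r hr)
  have hcase : ∀ (m' : Ideal R), m'.IsMaximal → m' ≠ m → ∀ z ∈ E ⊔ R ∙ x,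
      (∀ r ∈ m', r • z = 0) → z ∈ E := by
    intro m' hm' hne z hz hmz
    obtain ⟨e, he, z', hz', rfl⟩ := Submodule.mem_sup.1 hz
    obtain ⟨c, rfl⟩ := Submodule.mem_span_singleton.1 hz'
    have hco : m' ⊔ m = ⊤ := hm'.coprime_of_ne hm hne
    obtain ⟨s, hs, t, ht, hst⟩ := Submodule.mem_sup.1
      (show (1 : R) ∈ m' ⊔ m by rw [hco]; trivial)
    have h1 : e + c • x = t • e := by
      calc e + c • x = (s + t) • (e + c • x) := by rw [hst, one_smul]
        _ = t • e + c • t • x := by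
            rw [add_smul, hmz s hs, zero_add, smul_add, smul_comm t c x]
        _ = t • e := by rw [hx t ht, smul_zero, add_zero]
    rw [h1]
    exact E.smul_mem t he
  have hspan : ∀ z ∈ E ⊔ R ∙ x, (∀ r ∈ m, r • z = 0) → ∃ c : R, c • x = z := by
    intro z hz hmz
    obtain ⟨e, he, z', hz', rfl⟩ := Submodule.mem_sup.1 hz
    obtain ⟨c, rfl⟩ := Submodule.mem_span_singleton.1 hz'
    have h0 : e = 0 := hzero e he fun r hr => by
      have := hmz r hr
      rwa [smul_add, smul_comm r c x, hx r hr, smul_zero, add_zero] at this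
    exact ⟨c, by rw [h0, zero_add]⟩
  have hthin : HasThinSocle (E ⊔ R ∙ x) := by
    intro m' hm' y hy z hz hmy hmz h0
    by_cases hne : m' = m
    · subst hne
      obtain ⟨c, rfl⟩ := hspan y hy hmy
      obtain ⟨d, rfl⟩ := hspan z hz hmz
      have hc : c ∉ m' := fun hc => h0 (hx c hc)
      obtain ⟨b, hb⟩ := Ideal.Quotient.exists_inv (I := m')
        (a := Ideal.Quotient.mk m' c) (by rwa [Ne, Ideal.Quotient.eq_zero_iff_mem])
      obtain ⟨b, rfl⟩ := Ideal.Quotient.mk_surjective b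
      rw [← map_mul, ← map_one (Ideal.Quotient.mk m'), Ideal.Quotient.eq] at hb
      refine ⟨d * b, ?_⟩
      have h1 := hx _ hb
      rw [sub_smul, one_smul, sub_eq_zero, mul_comm] at h1
      rw [mul_smul, ← mul_smul b, h1]
    · exact hE.prop m' hm' y (hcase m' hm' hne y hy hmy) z (hcase m' hm' hne z hz hmz) hmy hmz h0
  have hxE : x ∈ E := hE.le_of_ge hthin le_sup_left
    (Submodule.mem_sup_right (Submodule.mem_span_singleton_self x))
  exact hx0 (hzero x hxE hx)

/-- A maximal submodule with thin socle of an injective module is a direct summand. -/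
lemma exists_retraction_of_maximal_hasThinSocle [Small.{v} R] {J : Type v} [AddCommGroup J]
    [Module R J] [Module.Injective R J] {E : Submodule R J} (hE : Maximal HasThinSocle E) :
    ∃ p : J →ₗ[R] E, ∀ e : E, p e = e := by
  -- Modulo a maximal complement `N`, the submodule `E` becomes essential. The inclusion of `E`
  -- extends to `g` on `J ⧸ N`, and the range of `g` contains `E` and has thin socle, so it equals
  -- `E`.
  obtain ⟨N, hN⟩ : ∃ N : Submodule R J, Maximal (Disjoint E) N := by
    refine zorn_le₀ {N | Disjoint E N} fun c hc hchain => ?_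
    rcases c.eq_empty_or_nonempty with rfl | hne
    · exact ⟨⊥, disjoint_bot_right, by simp⟩
    · refine ⟨sSup c, ?_, fun N hN => le_sSup hN⟩
      refine Submodule.disjoint_def.2 fun x hx hx' => ?_
      obtain ⟨N, hN, hxN⟩ := (Submodule.mem_sSup_of_directed hne hchain.directedOn).1 hx'
      exact Submodule.disjoint_def.1 (hc hN) x hx hxN
  have hNE := Submodule.disjoint_def.1 hN.prop
  let i : E →ₗ[R] J ⧸ N := N.mkQ ∘ₗ E.subtype
  have hi : Function.Injective i := by
    refine (injective_iff_map_eq_zero i).2 fun e he => ?_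
    exact Subtype.ext (hNE e e.2 ((Submodule.Quotient.mk_eq_zero N).1 he))
  -- every nonzero element of `J ⧸ N` has a nonzero multiple in `E`
  have hess : ∀ z : J ⧸ N, z ≠ 0 → ∃ (c : R) (e : E), e ≠ 0 ∧ i e = c • z := by
    intro z hz
    obtain ⟨x, rfl⟩ := N.mkQ_surjective z
    by_contra! hcon
    have hxN : x ∉ N := fun h => hz ((Submodule.Quotient.mk_eq_zero N).2 h)
    refine hxN (hN.le_of_ge (y := N ⊔ R ∙ x) ?_ le_sup_left
      (Submodule.mem_sup_right (Submodule.mem_span_singleton_self x)))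
    refine Submodule.disjoint_def.2 fun e he he' => ?_
    obtain ⟨n, hn, x', hx', rfl⟩ := Submodule.mem_sup.1 he'
    obtain ⟨c, rfl⟩ := Submodule.mem_span_singleton.1 hx'
    by_contra h0
    refine hcon c ⟨_, he⟩ (fun h => h0 (congrArg Subtype.val h)) ?_
    change N.mkQ (n + c • x) = c • N.mkQ x
    rw [map_add, map_smul, add_eq_right]
    exact (Submodule.Quotient.mk_eq_zero N).2 hn
  obtain ⟨g, hg⟩ := Module.Injective.extension_property R J E (J ⧸ N) i hi E.subtype
  have hg' : ∀ e : E, g (i e) = e := fun e => LinearMap.congr_fun hg e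
  have hmem : ∀ z, g z ∈ E := by
    have hthin : HasThinSocle (LinearMap.range g) := by
      -- Torsion in the range lies in `E`: some multiple `c • g z` is a nonzero element of `E`, so
      -- `c` is invertible modulo `m` and `g z` is recovered from that multiple.
      have key : ∀ (m : Ideal R), m.IsMaximal → ∀ z, (∀ r ∈ m, r • g z = 0) → g z ∈ E := by
        intro m hm z hmz
        by_cases h0 : z = 0
        · rw [h0, map_zero]; exact E.zero_mem
        obtain ⟨c, e, he, hce⟩ := hess z h0
        have h1 : (e : J) = c • g z := by rw [← map_smul, ← hce, hg']
        have hc : c ∉ m := fun hc => he (Subtype.ext (by rw [h1, hmz c hc]; rfl))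
        obtain ⟨b, hb⟩ := Ideal.Quotient.exists_inv (I := m)
          (a := Ideal.Quotient.mk m c) (by rwa [Ne, Ideal.Quotient.eq_zero_iff_mem])
        obtain ⟨b, rfl⟩ := Ideal.Quotient.mk_surjective b
        rw [← map_mul, ← map_one (Ideal.Quotient.mk m), Ideal.Quotient.eq] at hb
        have h2 := hmz _ hb
        rw [sub_smul, one_smul, sub_eq_zero, mul_comm, mul_smul, ← h1] at h2
        rw [← h2]
        exact E.smul_mem b e.2
      rintro m hm _ ⟨y, rfl⟩ _ ⟨z, rfl⟩ hmy hmz h0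
      exact hE.prop m hm _ (key m hm y hmy) _ (key m hm z hmz) hmy hmz h0
    have hle : E ≤ LinearMap.range g := fun e he => ⟨i ⟨e, he⟩, hg' ⟨e, he⟩⟩
    exact fun z => hE.le_of_ge hthin hle ⟨z, rfl⟩
  exact ⟨(g.codRestrict E hmem) ∘ₗ N.mkQ, fun e => Subtype.ext (hg' e)⟩

/-- A dualizing module `E`: functionals with values in `E` extend and separate points, and `E` has
thin socle. -/
structure IsDualizing (R : Type u) [CommRing R] (E : Type u) [AddCommGroup E] [Module R E] :
    Prop where
  injective : Module.Injective R E
  thin : HasThinSocle (⊤ : Submodule R E)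
  exists_torsion : ∀ (m : Ideal R), m.IsMaximal → ∃ e : E, e ≠ 0 ∧ ∀ r ∈ m, r • e = 0

/-- The character module of `R` is injective because `R` is flat, and it contains every `R ⧸ m`. A
maximal submodule with thin socle is a summand, hence injective, and keeps a copy of each simple
module. -/
lemma exists_isDualizing (R : Type u) [CommRing R] :
    ∃ (E : Type u) (_ : AddCommGroup E) (_ : Module R E), IsDualizing R E := by
  let J := CharacterModule R
  have hJ : Module.Injective R J := Module.Flat.iff_characterModule_injective.1 inferInstance
  obtain ⟨E, hE⟩ := exists_maximal_hasThinSocle R J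
  obtain ⟨p, hp⟩ := exists_retraction_of_maximal_hasThinSocle hE
  refine ⟨E, inferInstance, inferInstance, ⟨fun X Y _ _ _ _ f hf g => ?_⟩, ?_, ?_⟩
  · obtain ⟨h, hh⟩ := hJ.out f hf (E.subtype ∘ₗ g)
    exact ⟨p ∘ₗ h, fun x => by
      rw [LinearMap.comp_apply, hh, LinearMap.comp_apply, Submodule.subtype_apply, hp]⟩
  · intro m hm x _ y _ hmx hmy h0
    obtain ⟨c, hc⟩ := hE.prop m hm x x.2 y y.2 (fun r hr => congrArg Subtype.val (hmx r hr))
      (fun r hr => congrArg Subtype.val (hmy r hr)) (fun h => h0 (Subtype.ext h))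
    exact ⟨c, Subtype.ext hc⟩
  · intro m hm
    have h1 : (Ideal.Quotient.mk m 1) ≠ 0 := by
      rw [Ne, Ideal.Quotient.eq_zero_iff_mem]
      exact (Ideal.ne_top_iff_one m).1 hm.ne_top
    obtain ⟨c, hc⟩ := CharacterModule.exists_character_apply_ne_zero_of_ne_zero h1
    let x : J := CharacterModule.dual (R := R) m.mkQ c
    have hx0 : x ≠ 0 := fun h => hc (DFunLike.congr_fun h (1 : R))
    have hx : ∀ r ∈ m, r • x = 0 := by
      intro r hr
      ext s
      change c (Ideal.Quotient.mk m (r * s)) = 0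
      rw [Ideal.Quotient.eq_zero_iff_mem.2 (m.mul_mem_right s hr), map_zero]
    obtain ⟨y, hy, hy0, hmy⟩ := exists_ne_zero_of_maximal_hasThinSocle hE m hx0 hx
    exact ⟨⟨y, hy⟩, fun h => hy0 (congrArg Subtype.val h), fun r hr => Subtype.ext (hmy r hr)⟩

namespace IsDualizing

variable {E : Type u} [AddCommGroup E] [Module R E]

lemma exists_extension (hE : IsDualizing R E) {V W : Type*} [AddCommGroup V] [Module R V]
    [AddCommGroup W] [Module R W] (f : V →ₗ[R] W) (hf : Function.Injective f) (ξ : V →ₗ[R] E) :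
    ∃ η : W →ₗ[R] E, ∀ x, η (f x) = ξ x := by
  have := hE.injective
  obtain ⟨η, hη⟩ := Module.Injective.extension_property R E V W f hf ξ
  exact ⟨η, fun x => LinearMap.congr_fun hη x⟩

/-- The cyclic module generated by `x` has a simple quotient, which embeds into `E`; injectivity
extends the resulting functional to `V`. -/
lemma exists_apply_ne_zero (hE : IsDualizing R E) {V : Type*} [AddCommGroup V] [Module R V]
    {x : V} (hx : x ≠ 0) : ∃ ξ : V →ₗ[R] E, ξ x ≠ 0 := by
  have hne : LinearMap.ker (LinearMap.toSpanSingleton R V x) ≠ ⊤ := by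
    intro h
    have h1 : (1 : R) ∈ LinearMap.ker (LinearMap.toSpanSingleton R V x) := by rw [h]; trivial
    exact hx (by simpa using h1)
  obtain ⟨m, hm, hle⟩ := Ideal.exists_le_maximal _ hne
  obtain ⟨e, he, hme⟩ := hE.exists_torsion m hm
  obtain ⟨ξ, hξ⟩ := hE.exists_extension
    ((LinearMap.ker (LinearMap.toSpanSingleton R V x)).liftQ _ le_rfl)
    (LinearMap.ker_eq_bot.1 (Submodule.ker_liftQ_eq_bot _ _ _ le_rfl))
    ((LinearMap.ker (LinearMap.toSpanSingleton R V x)).liftQ (LinearMap.toSpanSingleton R E e)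
      fun r hr => by simpa using hme r (hle hr))
  refine ⟨ξ, ?_⟩
  have h1 := hξ (Submodule.Quotient.mk 1)
  simp only [Submodule.liftQ_apply, LinearMap.toSpanSingleton_apply, one_smul] at h1
  rwa [h1]

lemma exists_apply_ne_zero_of_notMem (hE : IsDualizing R E) {V : Type*} [AddCommGroup V]
    [Module R V] (N : Submodule R V) {x : V} (hx : x ∉ N) :
    ∃ ξ : V →ₗ[R] E, (∀ y ∈ N, ξ y = 0) ∧ ξ x ≠ 0 := by
  obtain ⟨ξ, hξ⟩ := hE.exists_apply_ne_zero (x := N.mkQ x)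
    (fun h => hx ((Submodule.Quotient.mk_eq_zero N).1 h))
  refine ⟨ξ ∘ₗ N.mkQ, fun y hy => ?_, hξ⟩
  rw [LinearMap.comp_apply, Submodule.mkQ_apply, (Submodule.Quotient.mk_eq_zero N).2 hy, map_zero]

/-- A functional on a simple module is determined by its value at a generator, which is killed by a
fixed maximal ideal. Thinness makes all such values multiples of any nonzero one. -/
lemma length_dual_le_one (hE : IsDualizing R E) (M : Type*) [AddCommGroup M] [Module R M]
    [IsSimpleModule R M] : Module.length R (M →ₗ[R] E) ≤ 1 := by
  rcases subsingleton_or_nontrivial (M →ₗ[R] E) with h | h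
  · rw [Module.length_eq_zero]; exact zero_le_one
  have : Nontrivial M := IsSimpleModule.nontrivial R M
  obtain ⟨x, hx⟩ := exists_ne (0 : M)
  have hspan := IsSimpleModule.toSpanSingleton_surjective R hx
  have hker : Ideal.IsMaximal (LinearMap.ker (LinearMap.toSpanSingleton R M x)) :=
    IsSimpleModule.ker_toSpanSingleton_isMaximal R hx
  have hext : ∀ φ ψ : M →ₗ[R] E, φ x = ψ x → φ = ψ := by
    intro φ ψ h
    ext y
    obtain ⟨r, rfl⟩ := hspan y
    simp [h]
  have htors : ∀ (φ : M →ₗ[R] E), ∀ r ∈ LinearMap.ker (LinearMap.toSpanSingleton R M x),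
      r • φ x = 0 := by
    intro φ r hr
    have hr' : r • x = 0 := by simpa using hr
    rw [← map_smul, hr', map_zero]
  have : IsSimpleModule R (M →ₗ[R] E) := by
    rw [isSimpleModule_iff_toSpanSingleton_surjective]
    refine ⟨h, fun φ hφ ψ => ?_⟩
    obtain ⟨c, hc⟩ := hE.thin _ hker (φ x) trivial (ψ x) trivial (htors φ) (htors ψ)
      (fun h0 => hφ (hext φ 0 h0))
    exact ⟨c, hext _ _ hc⟩
  exact Module.length_eq_one_iff.2 this |>.le

lemma length_dual_le (hE : IsDualizing R E) (M : Type*) [AddCommGroup M] [Module R M]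
    (hM : IsFiniteLength R M) : Module.length R (M →ₗ[R] E) ≤ Module.length R M := by
  induction hM with
  | of_subsingleton =>
    rw [Module.length_eq_zero]; exact zero_le
  | @of_simple_quotient M _ _ N _ _ ih =>
    have h1 : Module.length R (M →ₗ[R] E) ≤
        Module.length R ((M ⧸ N) →ₗ[R] E) + Module.length R (N →ₗ[R] E) := by
      rw [Module.length_eq_add_of_exact (LinearMap.ker (LinearMap.lcomp R E N.subtype)).subtype
        (LinearMap.lcomp R E N.subtype).rangeRestrict (Submodule.subtype_injective _)
        (LinearMap.surjective_rangeRestrict _) (by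
          rw [LinearMap.exact_iff, LinearMap.ker_rangeRestrict, Submodule.range_subtype])]
      refine add_le_add ?_ (Module.length_le_of_injective _ (Submodule.subtype_injective _))
      refine Module.length_le_of_surjective ((LinearMap.lcomp R E N.mkQ).codRestrict _ ?_) ?_
      · intro φ
        ext n
        exact (congrArg φ ((Submodule.Quotient.mk_eq_zero N).2 n.2)).trans (map_zero φ)
      · rintro ⟨φ, hφ⟩
        have hle : N ≤ LinearMap.ker φ := fun n hn => LinearMap.congr_fun hφ (⟨n, hn⟩ : N)
        exact ⟨N.liftQ φ hle, Subtype.ext (LinearMap.ext fun _ => rfl)⟩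
    have h2 := Module.length_eq_add_of_exact N.subtype N.mkQ (Submodule.subtype_injective _)
      N.mkQ_surjective (LinearMap.exact_subtype_mkQ N)
    have h3 : Module.length R (M ⧸ N) = 1 := Module.length_eq_one_iff.2 inferInstance
    rw [h2, h3, add_comm]
    exact h1.trans (by gcongr; exact hE.length_dual_le_one _)

lemma isFiniteLength_dual (hE : IsDualizing R E) (M : Type*) [AddCommGroup M] [Module R M]
    (hM : IsFiniteLength R M) : IsFiniteLength R (M →ₗ[R] E) := by
  rw [← Module.length_ne_top_iff] at hM ⊢
  exact ne_top_of_le_ne_top hM (hE.length_dual_le M (Module.length_ne_top_iff.1 hM))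

variable [IsArtinianRing R]

lemma finite_dual (hE : IsDualizing R E) (M : Type*) [AddCommGroup M] [Module R M]
    [Module.Finite R M] : Module.Finite R (M →ₗ[R] E) := by
  have hM : IsFiniteLength R M := isFiniteLength_iff_isNoetherian_isArtinian.2
    ⟨inferInstance, inferInstance⟩
  obtain ⟨_, _⟩ := isFiniteLength_iff_isNoetherian_isArtinian.1 (hE.isFiniteLength_dual M hM)
  infer_instance

/-- Evaluation embeds `M` into its bidual, whose length is at most that of `M`; by finite length the
image cannot be proper. -/
lemma eval_surjective (hE : IsDualizing R E) (M : Type*) [AddCommGroup M] [Module R M]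
    [Module.Finite R M] (θ : (M →ₗ[R] E) →ₗ[R] E) : ∃ x : M, ∀ φ : M →ₗ[R] E, φ x = θ φ := by
  have hM : IsFiniteLength R M := isFiniteLength_iff_isNoetherian_isArtinian.2
    ⟨inferInstance, inferInstance⟩
  have hM' := hE.isFiniteLength_dual M hM
  obtain ⟨_, _⟩ := isFiniteLength_iff_isNoetherian_isArtinian.1 (hE.isFiniteLength_dual _ hM')
  let ev : M →ₗ[R] (M →ₗ[R] E) →ₗ[R] E := LinearMap.flip LinearMap.id
  have hinj : Function.Injective ev := by
    refine (injective_iff_map_eq_zero ev).2 fun x hx => ?_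
    by_contra h0
    obtain ⟨ξ, hξ⟩ := hE.exists_apply_ne_zero h0
    exact hξ (LinearMap.congr_fun hx ξ)
  have htop : LinearMap.range ev = ⊤ := by
    by_contra hne
    have h1 := Submodule.length_lt hne
    rw [← (LinearEquiv.ofInjective ev hinj).length_eq] at h1
    exact absurd h1 (not_lt.2 ((hE.length_dual_le _ hM').trans (hE.length_dual_le M hM)))
  obtain ⟨x, hx⟩ := LinearMap.range_eq_top.1 htop θ
  exact ⟨x, fun φ => LinearMap.congr_fun hx φ⟩

end IsDualizing

end Matlis

/-! ### Finite presentation of `D Hom_A(-, Y)` -/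

section ModuleDuality

variable {k : Type u} [CommRing k] {E : Type u} [AddCommGroup E] [Module k E]
  {A : Type u} [Ring A] [Algebra k A]

/-- Evaluation at `x` as a `k`-linear map on a space of `A`-linear maps. -/
def evalLinear (k : Type u) [CommRing k] {A : Type u} [Ring A] [Algebra k A] {X : Type*}
    (Y : Type*) [AddCommGroup X] [Module A X] [AddCommGroup Y] [Module A Y] [Module k Y]
    [IsScalarTower k A Y] (x : X) : (X →ₗ[A] Y) →ₗ[k] Y where
  toFun w := w x
  map_add' _ _ := rfl
  map_smul' _ _ := rfl

lemma exists_linearMap_of_ker_le {R M N P : Type*} [Ring R] [AddCommGroup M] [Module R M]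
    [AddCommGroup N] [Module R N] [AddCommGroup P] [Module R P] (f : M →ₗ[R] N)
    (hf : Function.Surjective f) (g : M →ₗ[R] P) (h : ∀ x, f x = 0 → g x = 0) :
    ∃ t : N →ₗ[R] P, ∀ x, t (f x) = g x := by
  refine ⟨(LinearMap.ker f).liftQ g (fun x hx => h x hx) ∘ₗ
    (f.quotKerEquivOfSurjective hf).symm.toLinearMap, fun x => ?_⟩
  have : (f.quotKerEquivOfSurjective hf).symm (f x) = Submodule.Quotient.mk x := by
    rw [LinearEquiv.symm_apply_eq]; rfl
  rw [LinearMap.comp_apply, LinearEquiv.coe_coe, this]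
  rfl

lemma linearMap_eq_sum_single {R Z N : Type*} [Ring R] [AddCommGroup Z] [Module R Z]
    [AddCommGroup N] [Module R N] {n : ℕ} (η : (Fin n → Z) →ₗ[R] N) (v : Fin n → Z) :
    η v = ∑ i, (η ∘ₗ LinearMap.single R (fun _ => Z) i) (v i) := by
  conv_lhs => rw [← Finset.univ_sum_single v, map_sum]
  rfl

/-- A functional on `Hom_A(X, Z)` is a sum of functionals on `Z` evaluated at generators of `X`. -/
lemma IsDualizing.exists_eq_sum_eval (hE : IsDualizing k E) {X Z : Type*} [AddCommGroup X]
    [Module A X] [AddCommGroup Z] [Module A Z] [Module k Z] [IsScalarTower k A Z] {n : ℕ}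
    (x : Fin n → X) (hx : Submodule.span A (Set.range x) = ⊤) (ξ : (X →ₗ[A] Z) →ₗ[k] E) :
    ∃ l : Fin n → (Z →ₗ[k] E), ∀ w, ξ w = ∑ i, l i (w (x i)) := by
  obtain ⟨η, hη⟩ := hE.exists_extension (LinearMap.pi fun i => evalLinear k Z (x i)) (by
    intro w w' h
    exact LinearMap.ext_on_range hx fun i => congrFun h i) ξ
  refine ⟨fun i => η ∘ₗ LinearMap.single k (fun _ => Z) i, fun w => ?_⟩
  rw [← hη, linearMap_eq_sum_single]
  rfl

section Covariant

variable {Y : Type*} [AddCommGroup Y] [Module A Y] [Module k Y] [IsScalarTower k A Y]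

/-- The map sending a tuple `r` to the functional `∑ i, y i (r i • -)`. -/
def sumSMul {n : ℕ} (y : Fin n → (Y →ₗ[k] E)) : (Fin n → A) →ₗ[k] (Y →ₗ[k] E) where
  toFun r := ∑ i, y i ∘ₗ Algebra.lsmul k k Y (r i)
  map_add' r s := by
    rw [← Finset.sum_add_distrib]
    exact Finset.sum_congr rfl fun i _ => by rw [Pi.add_apply, map_add, LinearMap.comp_add]
  map_smul' c r := by
    rw [RingHom.id_apply, Finset.smul_sum]
    exact Finset.sum_congr rfl fun i _ => by rw [Pi.smul_apply, map_smul, LinearMap.comp_smul]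

lemma sumSMul_apply {n : ℕ} (y : Fin n → (Y →ₗ[k] E)) (r : Fin n → A) (x : Y) :
    sumSMul y r x = ∑ i, y i (r i • x) := by
  simp [sumSMul]

lemma sumSMul_surjective {n : ℕ} {y : Fin n → (Y →ₗ[k] E)}
    (hy : Submodule.span k (Set.range y) = ⊤) :
    Function.Surjective (sumSMul (A := A) y) := by
  intro φ
  have hφ : φ ∈ Submodule.span k (Set.range y) := by rw [hy]; trivial
  obtain ⟨c, rfl⟩ := (Submodule.mem_span_range_iff_exists_fun k).1 hφ
  refine ⟨fun i => algebraMap k A (c i), LinearMap.ext fun x => ?_⟩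
  simp [sumSMul_apply]

variable [IsArtinianRing k] [Module.Finite k Y]

/-- By duality, `A`-linear maps `Z → Y` are maps of right modules `DY → DZ`, given by images `l i`
of the generators `y i` that respect the relations. The value at `z` is the point of `Y`
representing the functional `∑ y i (r i • -) ↦ ∑ l i (r i • z)` on `DY`. -/
lemma IsDualizing.exists_linearMap_of_relations (hE : IsDualizing k E) {n : ℕ}
    {y : Fin n → (Y →ₗ[k] E)} (hy : Submodule.span k (Set.range y) = ⊤)
    {Z : Type*} [AddCommGroup Z] [Module A Z] [Module k Z] [IsScalarTower k A Z]
    (l : Fin n → (Z →ₗ[k] E))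
    (hl : ∀ r : Fin n → A, sumSMul y r = 0 → ∀ z, ∑ i, l i (r i • z) = 0) :
    ∃ w : Z →ₗ[A] Y, ∀ i z, y i (w z) = l i z := by
  have hsurj := sumSMul_surjective (A := A) hy
  have huniq : ∀ a b : Y, (∀ r : Fin n → A, sumSMul y r a = sumSMul y r b) → a = b := by
    intro a b hab
    by_contra hne
    obtain ⟨ξ, hξ⟩ := hE.exists_apply_ne_zero (sub_ne_zero.2 hne)
    obtain ⟨r, rfl⟩ := hsurj ξ
    exact hξ (by rw [map_sub, hab, sub_self])
  have hex : ∀ z : Z, ∃ a : Y, ∀ r : Fin n → A, sumSMul y r a = ∑ i, l i (r i • z) := by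
    intro z
    obtain ⟨θ, hθ⟩ := exists_linearMap_of_ker_le (sumSMul (A := A) y) hsurj
      ((sumSMul (A := A) l).flip z) (fun r hr => by
        rw [LinearMap.flip_apply, sumSMul_apply]; exact hl r hr z)
    obtain ⟨a, ha⟩ := hE.eval_surjective Y θ
    exact ⟨a, fun r => by rw [ha, hθ, LinearMap.flip_apply, sumSMul_apply]⟩
  choose w hw using hex
  refine ⟨{ toFun := w, map_add' := fun z z' => ?_, map_smul' := fun b z => ?_ }, fun i z => ?_⟩
  · refine huniq _ _ fun r => ?_
    simp only [map_add, hw, smul_add, Finset.sum_add_distrib]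
  · refine huniq _ _ fun r => ?_
    have h1 : sumSMul y r (b • w z) = sumSMul y (fun i => r i * b) (w z) := by
      simp [sumSMul_apply, mul_smul]
    rw [RingHom.id_apply, h1, hw, hw]
    simp [mul_smul]
  · have h1 := hw z (Pi.single i 1)
    rw [sumSMul_apply, Fintype.sum_eq_single i, Fintype.sum_eq_single i] at h1
    · simpa using h1
    · intro j hj; simp [hj]
    · intro j hj; simp [hj]

/-- The functor `Z ↦ Hom_k(Hom_A(Z, Y), E)` is finitely presented. -/
lemma IsDualizing.exists_presentation_dual_hom_to (hE : IsDualizing k E) [Module.Finite k A]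
    (Y : Type u) [AddCommGroup Y] [Module A Y] [Module k Y] [IsScalarTower k A Y]
    [Module.Finite k Y] :
    ∃ (n m : ℕ) (p : (Fin n → A) →ₗ[A] (Fin m → A)) (τ : ((Fin n → A) →ₗ[A] Y) →ₗ[k] E),
      (∀ (Z : Type u) [AddCommGroup Z] [Module A Z] [Module k Z] [IsScalarTower k A Z]
        [Module.Finite A Z] (ξ : (Z →ₗ[A] Y) →ₗ[k] E),
        ∃ a : (Fin n → A) →ₗ[A] Z, ∀ w, ξ w = τ (w ∘ₗ a)) ∧
      (∀ (Z : Type u) [AddCommGroup Z] [Module A Z] [Module k Z] [IsScalarTower k A Z]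
        (a : (Fin n → A) →ₗ[A] Z), (∀ w, τ (w ∘ₗ a) = 0) ↔ ∃ b, b ∘ₗ p = a) := by
  -- Conceptually `D Hom_A(Z, Y)` is `DY ⊗_A Z`, so a finite presentation of the right module `DY`
  -- exhibits it as the cokernel of a map `Z ^ m → Z ^ n`. Generators and relations are taken over
  -- `k`, which avoids right module structures.
  have := hE.finite_dual Y
  obtain ⟨n, y, hy⟩ := Module.Finite.exists_fin (R := k) (M := Y →ₗ[k] E)
  obtain ⟨m, r, hr⟩ := Submodule.fg_iff_exists_fin_generating_family.1
    (IsNoetherian.noetherian (LinearMap.ker (sumSMul (A := A) y)))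
  have hr0 : ∀ j, sumSMul y (r j) = 0 := fun j => by
    rw [← LinearMap.mem_ker, ← hr]; exact Submodule.subset_span ⟨j, rfl⟩
  let e : Fin n → (Fin n → A) := fun i => Pi.single i 1
  have hext : ∀ {Z : Type u} [AddCommGroup Z] [Module A Z] (a b : (Fin n → A) →ₗ[A] Z),
      (∀ i, a (e i) = b (e i)) → a = b := by
    intro Z _ _ a b h
    exact (Pi.basisFun A (Fin n)).ext fun i => by simpa [e] using h i
  let p : (Fin n → A) →ₗ[A] (Fin m → A) := Fintype.linearCombination A fun i j => r j i
  have hp : ∀ i, p (e i) = fun j => r j i := fun i => by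
    simp [p, e, Fintype.linearCombination_apply_single]
  let τ : ((Fin n → A) →ₗ[A] Y) →ₗ[k] E := ∑ i, y i ∘ₗ evalLinear k Y (e i)
  have hτ : ∀ w, τ w = ∑ i, y i (w (e i)) := fun w => by simp [τ, evalLinear]
  have hsum : ∀ {Z : Type u} [AddCommGroup Z] [Module A Z] (b : (Fin m → A) →ₗ[A] Z) (i : Fin n),
      b (p (e i)) = ∑ j, r j i • b (Pi.single j 1) := by
    intro Z _ _ b i
    rw [hp]
    conv_lhs => rw [← Finset.univ_sum_single (fun j => r j i), map_sum]
    refine Finset.sum_congr rfl fun j _ => ?_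
    rw [← map_smul, ← Pi.single_smul, smul_eq_mul, mul_one]
  refine ⟨n, m, p, τ, ?_, ?_⟩
  · intro Z _ _ _ _ _ ξ
    obtain ⟨q, z, hz⟩ := Module.Finite.exists_fin (R := A) (M := Z)
    obtain ⟨l, hl⟩ := hE.exists_eq_sum_eval z hz ξ
    have hc : ∀ j, ∃ c : Fin n → k, ∑ i, c i • y i = l j := fun j =>
      (Submodule.mem_span_range_iff_exists_fun k).1 (by rw [hy]; trivial)
    choose c hc using hc
    let a : (Fin n → A) →ₗ[A] Z := Fintype.linearCombination A fun i => ∑ j, c j i • z j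
    have ha : ∀ i, a (e i) = ∑ j, c j i • z j := fun i => by
      simp [a, e, Fintype.linearCombination_apply_single]
    refine ⟨a, fun w => ?_⟩
    rw [hl, hτ]
    simp only [LinearMap.comp_apply, ha, map_sum, ← hc, LinearMap.sum_apply, LinearMap.smul_apply]
    rw [Finset.sum_comm]
    refine Finset.sum_congr rfl fun i _ => Finset.sum_congr rfl fun j _ => ?_
    rw [LinearMap.map_smul_of_tower w, map_smul]
  · intro Z _ _ _ _ a
    constructor
    · intro h
      let W : (Fin m → Z) →ₗ[k] (Fin n → Z) :=
        LinearMap.pi fun i => ∑ j, Algebra.lsmul k k Z (r j i) ∘ₗ LinearMap.proj j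
      have hW : ∀ (z : Fin m → Z) i, W z i = ∑ j, r j i • z j := fun z i => by simp [W]
      -- A functional separating this tuple from the range of `W` has components satisfying the
      -- relations of `y`, so they come from an `A`-linear `w : Z → Y`; the vanishing of `τ (w ∘ₗ
      -- a)` is then a contradiction.
      have hmem : (fun i => a (e i)) ∈ LinearMap.range W := by
        by_contra hcon
        obtain ⟨ξ, hξ, hξa⟩ := hE.exists_apply_ne_zero_of_notMem _ hcon
        let l : Fin n → (Z →ₗ[k] E) := fun i => ξ ∘ₗ LinearMap.single k (fun _ => Z) i
        have hl : ∀ v : Fin n → Z, ∑ i, l i (v i) = ξ v := fun v =>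
          (linearMap_eq_sum_single ξ v).symm
        have hrel : ∀ s : Fin n → A, sumSMul y s = 0 → ∀ z, ∑ i, l i (s i • z) = 0 := by
          intro s hs z
          have hs' : s ∈ Submodule.span k (Set.range r) := by rw [hr]; exact hs
          have hle : Submodule.span k (Set.range r) ≤ LinearMap.ker ((sumSMul l).flip z) := by
            rw [Submodule.span_le]
            rintro _ ⟨j, rfl⟩
            change sumSMul l (r j) z = 0
            rw [sumSMul_apply, hl]
            refine hξ _ ⟨Pi.single j z, funext fun i => ?_⟩
            rw [hW, Fintype.sum_eq_single j]
            · simp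
            · intro j' hj'; simp [hj']
          have h1 : sumSMul l s z = 0 := hle hs'
          rwa [sumSMul_apply] at h1
        obtain ⟨w, hw⟩ := hE.exists_linearMap_of_relations hy l hrel
        apply hξa
        rw [← hl, ← h w, hτ]
        exact Finset.sum_congr rfl fun i _ => (hw i _).symm
      obtain ⟨z, hz⟩ := hmem
      refine ⟨Fintype.linearCombination A z, hext _ _ fun i => ?_⟩
      rw [LinearMap.comp_apply, hsum, ← congrFun hz i, hW]
      simp [Fintype.linearCombination_apply_single]
    · rintro ⟨b, rfl⟩ w
      rw [hτ]
      simp only [LinearMap.comp_apply, hsum, map_sum, map_smul]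
      rw [Finset.sum_comm]
      refine Finset.sum_eq_zero fun j _ => ?_
      rw [← sumSMul_apply, hr0, LinearMap.zero_apply]

end Covariant

end ModuleDuality

/-! ### Finite presentation of `D Hom_A(X, -)` -/

section Contravariant

variable {k : Type u} [CommRing k] {E : Type u} [AddCommGroup E] [Module k E]
  {A : Type u} [Ring A] [Algebra k A]

/-- The `k`-dual of the free right `A`-module of rank `n`, as a left `A`-module. -/
def FreeDual (k : Type u) [CommRing k] (A : Type u) [Ring A] [Algebra k A] (E : Type u)
    [AddCommGroup E] [Module k E] (n : ℕ) : Type u :=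
  (Fin n → A) →ₗ[k] E

namespace FreeDual

variable {n : ℕ}

instance : AddCommGroup (FreeDual k A E n) :=
  inferInstanceAs (AddCommGroup ((Fin n → A) →ₗ[k] E))

instance : Module k (FreeDual k A E n) :=
  inferInstanceAs (Module k ((Fin n → A) →ₗ[k] E))

instance : FunLike (FreeDual k A E n) (Fin n → A) E :=
  inferInstanceAs (FunLike ((Fin n → A) →ₗ[k] E) (Fin n → A) E)

instance : LinearMapClass (FreeDual k A E n) k (Fin n → A) E :=
  inferInstanceAs (LinearMapClass ((Fin n → A) →ₗ[k] E) k (Fin n → A) E)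

instance : SMul A (FreeDual k A E n) where
  smul b φ := LinearMap.comp (show (Fin n → A) →ₗ[k] E from φ)
    (LinearMap.pi fun i => LinearMap.mulRight k b ∘ₗ LinearMap.proj i)

@[ext] lemma ext {φ ψ : FreeDual k A E n} (h : ∀ c, φ c = ψ c) : φ = ψ := DFunLike.ext _ _ h

lemma add_apply (φ ψ : FreeDual k A E n) (c : Fin n → A) : (φ + ψ) c = φ c + ψ c := rfl

lemma zero_apply (c : Fin n → A) : (0 : FreeDual k A E n) c = 0 := rfl

lemma smul_apply (b : A) (φ : FreeDual k A E n) (c : Fin n → A) :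
    (b • φ) c = φ fun i => c i * b := rfl

lemma base_smul_apply (r : k) (φ : FreeDual k A E n) (c : Fin n → A) : (r • φ) c = r • φ c := rfl

instance : Module A (FreeDual k A E n) where
  one_smul φ := ext fun c => by simp [smul_apply]
  mul_smul a b φ := ext fun c => by simp [smul_apply, mul_assoc]
  smul_zero a := ext fun c => rfl
  smul_add a φ ψ := ext fun c => rfl
  add_smul a b φ := ext fun c => by
    simp only [smul_apply, add_apply, mul_add]
    exact map_add φ (fun i => c i * a) fun i => c i * b
  zero_smul φ := ext fun c => by
    simp only [smul_apply, zero_apply, mul_zero]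
    exact map_zero φ

instance : IsScalarTower k A (FreeDual k A E n) where
  smul_assoc r b φ := ext fun c => by
    simp only [smul_apply, base_smul_apply, mul_smul_comm]
    exact map_smul φ r fun i => c i * b

lemma apply_eq_sum (φ : FreeDual k A E n) (c : Fin n → A) :
    φ c = ∑ i, (c i • φ) (Pi.single i 1) := by
  conv_lhs => rw [← Finset.univ_sum_single c, map_sum]
  refine Finset.sum_congr rfl fun i _ => ?_
  rw [smul_apply]
  congr 1
  ext j
  by_cases h : j = i
  · subst h; simp
  · simp [h]

lemma finite [IsArtinianRing k] [Module.Finite k A] (hE : IsDualizing k E) :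
    Module.Finite A (FreeDual k A E n) := by
  have : Module.Finite k (FreeDual k A E n) := hE.finite_dual (Fin n → A)
  exact Module.Finite.of_restrictScalars_finite k A _

/-- The `A`-linear map into the dual of a free module attached to a functional on `Z ^ n`. -/
def lift {Z : Type*} [AddCommGroup Z] [Module A Z] [Module k Z] [IsScalarTower k A Z]
    (η : (Fin n → Z) →ₗ[k] E) : Z →ₗ[A] FreeDual k A E n where
  toFun z := η ∘ₗ LinearMap.pi fun i => (Algebra.lsmul k k Z).toLinearMap.flip z ∘ₗ LinearMap.proj i
  map_add' z z' := ext fun c => by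
    change η (fun i => c i • (z + z')) = η (fun i => c i • z) + η (fun i => c i • z')
    rw [← map_add]
    simp only [smul_add]
    rfl
  map_smul' b z := ext fun c => by
    change η (fun i => c i • b • z) = η (fun i => (c i * b) • z)
    simp only [mul_smul]

lemma lift_apply {Z : Type*} [AddCommGroup Z] [Module A Z] [Module k Z] [IsScalarTower k A Z]
    (η : (Fin n → Z) →ₗ[k] E) (z : Z) (c : Fin n → A) : lift η z c = η fun i => c i • z := rfl

/-- The map on duals induced by a matrix acting on column vectors from the left. -/
def mapMatrix {m : ℕ} (r : Fin m → Fin n → A) : FreeDual k A E m →ₗ[A] FreeDual k A E n where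
  toFun φ := LinearMap.comp (show (Fin m → A) →ₗ[k] E from φ)
    (LinearMap.pi fun j => ∑ i, LinearMap.mulLeft k (r j i) ∘ₗ LinearMap.proj i)
  map_add' _ _ := rfl
  map_smul' b φ := ext fun c => by
    change φ _ = φ _
    congr 1
    ext j
    simp [mul_assoc]

lemma mapMatrix_apply {m : ℕ} (r : Fin m → Fin n → A) (φ : FreeDual k A E m) (c : Fin n → A) :
    mapMatrix r φ c = φ fun j => ∑ i, r j i * c i := by
  change φ _ = φ _
  congr 1
  ext j
  simp

end FreeDual

/-- The functor `Z ↦ Hom_k(Hom_A(X, Z), E)` is finitely presented as a contravariant functor. -/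
lemma IsDualizing.exists_presentation_dual_hom_from (hE : IsDualizing k E) [IsNoetherianRing A]
    (X : Type u) [AddCommGroup X] [Module A X] [Module.Finite A X] :
    ∃ (n m : ℕ) (p : FreeDual k A E m →ₗ[A] FreeDual k A E n)
      (τ : (X →ₗ[A] FreeDual k A E n) →ₗ[k] E),
      (∀ (Z : Type u) [AddCommGroup Z] [Module A Z] [Module k Z] [IsScalarTower k A Z]
        (ξ : (X →ₗ[A] Z) →ₗ[k] E),
        ∃ a : Z →ₗ[A] FreeDual k A E n, ∀ w, ξ w = τ (a ∘ₗ w)) ∧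
      (∀ (Z : Type u) [AddCommGroup Z] [Module A Z] [Module k Z] [IsScalarTower k A Z]
        (a : Z →ₗ[A] FreeDual k A E n), (∀ w, τ (a ∘ₗ w) = 0) ↔ ∃ b, p ∘ₗ b = a) := by
  -- A presentation of `X` makes `Hom_A(X, Z)` the kernel of a map `Z ^ n → Z ^ m`, so its dual is
  -- the cokernel of `D(Z ^ m) → D(Z ^ n)`. By adjunction, `D(Z ^ n)` is the group of `A`-linear
  -- maps from `Z` to `FreeDual k A E n`.
  obtain ⟨n, x, hx⟩ := Module.Finite.exists_fin (R := A) (M := X)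
  have hsurj : Function.Surjective (Fintype.linearCombination A x) := by
    rw [← LinearMap.range_eq_top, Fintype.range_linearCombination, hx]
  obtain ⟨m, r, hr⟩ := Submodule.fg_iff_exists_fin_generating_family.1
    (IsNoetherian.noetherian (LinearMap.ker (Fintype.linearCombination A x)))
  have hr0 : ∀ j, ∑ i, r j i • x i = 0 := fun j => by
    have : r j ∈ LinearMap.ker (Fintype.linearCombination A x) := by
      rw [← hr]; exact Submodule.subset_span ⟨j, rfl⟩
    simpa [Fintype.linearCombination_apply] using this
  let ev : Fin n → (FreeDual k A E n →ₗ[k] E) := fun i =>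
    { toFun φ := φ (Pi.single i 1), map_add' _ _ := rfl, map_smul' _ _ := rfl }
  let τ : (X →ₗ[A] FreeDual k A E n) →ₗ[k] E := ∑ i, ev i ∘ₗ evalLinear k _ (x i)
  have hτ : ∀ w, τ w = ∑ i, w (x i) (Pi.single i 1) := fun w => by
    simp only [τ, LinearMap.sum_apply]
    rfl
  refine ⟨n, m, FreeDual.mapMatrix r, τ, ?_, ?_⟩
  · intro Z _ _ _ _ ξ
    obtain ⟨l, hl⟩ := hE.exists_eq_sum_eval x hx ξ
    refine ⟨FreeDual.lift (∑ i, l i ∘ₗ LinearMap.proj i), fun w => ?_⟩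
    rw [hl, hτ]
    refine Finset.sum_congr rfl fun i _ => ?_
    rw [LinearMap.comp_apply, FreeDual.lift_apply, LinearMap.sum_apply, Fintype.sum_eq_single i]
    · simp
    · intro j hj; simp [hj]
  · intro Z _ _ _ _ a
    constructor
    · intro h
      let G : (Fin n → Z) →ₗ[k] (Fin m → Z) :=
        LinearMap.pi fun j => ∑ i, Algebra.lsmul k k Z (r j i) ∘ₗ LinearMap.proj i
      have hG : ∀ (z : Fin n → Z) j, G z j = ∑ i, r j i • z i := fun z j => by simp [G]
      let l : Fin n → (Z →ₗ[k] E) := fun i => ev i ∘ₗ a.restrictScalars k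
      have hl : ∀ i z, l i z = a z (Pi.single i 1) := fun i z => rfl
      let L : (Fin n → Z) →ₗ[k] E := ∑ i, l i ∘ₗ LinearMap.proj i
      have hL : ∀ z, L z = ∑ i, l i (z i) := fun z => by simp [L]
      -- A tuple killed by `G` satisfies the relations of `X`, so it is the image of the generators
      -- under some `w : X → Z`, and `L z` is `τ (a ∘ₗ w)`.
      have hker : ∀ z, G z = 0 → L z = 0 := by
        intro z hz
        obtain ⟨w, hw⟩ := exists_linearMap_of_ker_le _ hsurj (Fintype.linearCombination A z) (by
          intro s hs
          have hs' : s ∈ Submodule.span A (Set.range r) := by rw [hr]; exact hs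
          have hle : Submodule.span A (Set.range r) ≤
              LinearMap.ker (Fintype.linearCombination A z) := by
            rw [Submodule.span_le]
            rintro _ ⟨j, rfl⟩
            have h1 := congrFun hz j
            rw [hG] at h1
            simpa [Fintype.linearCombination_apply] using h1
          exact hle hs')
        have hw' : ∀ i, w (x i) = z i := fun i => by
          have := hw (Pi.single i 1)
          simpa [Fintype.linearCombination_apply_single] using this
        have h1 := h w
        rw [hτ] at h1
        rw [hL, ← h1]
        exact Finset.sum_congr rfl fun i _ => by rw [hl, LinearMap.comp_apply, hw']
      obtain ⟨μ, hμ⟩ := hE.exists_extension ((LinearMap.ker G).liftQ G le_rfl)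
        (LinearMap.ker_eq_bot.1 (Submodule.ker_liftQ_eq_bot _ _ _ le_rfl))
        ((LinearMap.ker G).liftQ L hker)
      have hμ' : ∀ z, μ (G z) = L z := fun z => hμ (Submodule.Quotient.mk z)
      refine ⟨FreeDual.lift μ, LinearMap.ext fun z => FreeDual.ext fun c => ?_⟩
      rw [LinearMap.comp_apply, FreeDual.mapMatrix_apply, FreeDual.lift_apply]
      have h1 : (fun j => (∑ i, r j i * c i) • z) = G fun i => c i • z := by
        ext j
        rw [hG, Finset.sum_smul]
        simp only [mul_smul]
      rw [h1, hμ', hL, FreeDual.apply_eq_sum (a z)]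
      exact Finset.sum_congr rfl fun i _ => by rw [hl, map_smul]
    · rintro ⟨b, rfl⟩ w
      rw [hτ]
      have h1 : ∀ i, (FreeDual.mapMatrix r ∘ₗ b ∘ₗ w) (x i) (Pi.single i 1) =
          ∑ j, b (w (r j i • x i)) (Pi.single j 1) := by
        intro i
        rw [LinearMap.comp_apply, FreeDual.mapMatrix_apply, FreeDual.apply_eq_sum]
        refine Finset.sum_congr rfl fun j _ => ?_
        rw [Fintype.sum_eq_single i, Pi.single_eq_same, mul_one, map_smul, map_smul]
        · rfl
        · intro i' hi'; simp [hi']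
      refine (Finset.sum_congr rfl fun i _ => h1 i).trans ?_
      rw [Finset.sum_comm]
      refine Finset.sum_eq_zero fun j _ => ?_
      let ev' : FreeDual k A E m →+ E :=
        { toFun φ := φ (Pi.single j 1), map_zero' := rfl, map_add' _ _ := rfl }
      change ∑ i, ev' (b (w (r j i • x i))) = 0
      rw [← map_sum, ← map_sum, ← map_sum, hr0, map_zero, map_zero, map_zero]

end Contravariant

/-! ### From separating functionals to factorizations -/

section Duality

/-- The opposite of a linear category is linear. -/
instance linearOpposite (k : Type*) [Semiring k] (C : Type*) [Category* C] [Preadditive C]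
    [Linear k C] : Linear k Cᵒᵖ where
  homModule _ _ :=
    { smul r f := (r • f.unop).op
      one_smul f := Quiver.Hom.unop_inj (one_smul k f.unop)
      mul_smul r s f := Quiver.Hom.unop_inj (mul_smul r s f.unop)
      smul_zero r := Quiver.Hom.unop_inj (smul_zero r)
      smul_add r f g := Quiver.Hom.unop_inj (smul_add r f.unop g.unop)
      add_smul r s f := Quiver.Hom.unop_inj (add_smul r s f.unop)
      zero_smul f := Quiver.Hom.unop_inj (zero_smul k f.unop) }
  smul_comp _ _ _ r f g := Quiver.Hom.unop_inj (Linear.comp_smul _ _ _ g.unop r f.unop)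
  comp_smul _ _ _ f r g := Quiver.Hom.unop_inj (Linear.smul_comp _ _ _ r g.unop f.unop)

variable (k : Type u) [CommRing k] (E : Type u) [AddCommGroup E] [Module k E]

/-- The functors `Z ↦ Hom_k(Hom(Z, Y), E)` are finitely presented, in elementary form: `τ` is a
generator and `p` generates the annihilator of `τ`. -/
def HasFpDuals (C : Type w) [Category.{v} C] [Preadditive C] [Linear k C] : Prop :=
  ∀ Y : C, ∃ (P Q : C) (p : P ⟶ Q) (τ : (P ⟶ Y) →ₗ[k] E),
    (∀ (Z : C) (ξ : (Z ⟶ Y) →ₗ[k] E), ∃ a : P ⟶ Z, ∀ w, ξ w = τ (a ≫ w)) ∧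
    (∀ (Z : C) (a : P ⟶ Z), (∀ w : Z ⟶ Y, τ (a ≫ w) = 0) ↔ ∃ b, p ≫ b = a)

/-- `k`-linear functionals with values in `E` separate points from submodules. -/
def IsCogenerator : Prop :=
  ∀ (V : Type v) [AddCommGroup V] [Module k V] (N : Submodule k V) (x : V), x ∉ N →
    ∃ ξ : V →ₗ[k] E, (∀ y ∈ N, ξ y = 0) ∧ ξ x ≠ 0

variable {C : Type w} [Category.{v} C] [Preadditive C] [Linear k C]

/-- The morphisms of a nonempty ideal form a submodule of each morphism space. -/
def IsIdeal.submodule {I : MorphismProperty C} (hI : IsIdeal I) {X₀ Y₀ : C} {f₀ : X₀ ⟶ Y₀}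
    (h₀ : I f₀) (X Y : C) : Submodule k (X ⟶ Y) where
  carrier := {f | I f}
  add_mem' := hI.add_mem _ _
  zero_mem' := by simpa using hI.comp_mem (0 : X ⟶ X₀) f₀ (0 : Y₀ ⟶ Y) h₀
  smul_mem' r f hf := by simpa using hI.postcomp hf (r • 𝟙 Y)

variable {k E}

/-- Write a functional `ξ` that kills `I(X, M) ≫ f` but not `φ` as `τ (a ≫ -)`. Morphisms `b` with
`τ (b ≫ w ≫ f) = 0` for all `w` are those factoring through `s`. Since `ξ` kills `I(X, M) ≫ f`, the
pushout of `s` along `a` is left `I`-factoring. -/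
lemma IsLeftIdempotent.isRightIdempotent [HasPushouts C] (hE : IsCogenerator.{u, v} k E)
    (hC : HasFpDuals k E C) {I : MorphismProperty C} (hI : IsIdeal I) (h : IsLeftIdempotent I) : IsRightIdempotent I := by
  intro M Y f hf X φ hφ
  by_contra hcon
  obtain ⟨ξ, hξI, hξφ⟩ := hE _
    ((hI.submodule k hφ X M).map (Linear.rightComp k X f)) φ (fun ⟨g, hg, e⟩ => hcon ⟨g, hg, e⟩)
  have hξ : ∀ g : X ⟶ M, I g → ξ (g ≫ f) = 0 := fun g hg => hξI _ ⟨g, hg, rfl⟩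
  obtain ⟨P, _, _, τ, hτ, -⟩ := hC Y
  obtain ⟨P', Q', p', τ', hτ', hp'⟩ := hC M
  obtain ⟨a, ha⟩ := hτ X ξ
  obtain ⟨α, hα⟩ := hτ' P (τ ∘ₗ Linear.rightComp k P f)
  have hα' : ∀ w : P ⟶ M, τ (w ≫ f) = τ' (α ≫ w) := hα
  let s := pushout.inl α p'
  have hs : ∀ {Z : C} (b : P ⟶ Z), (∃ v, s ≫ v = b) ↔ ∀ w : Z ⟶ M, τ (b ≫ w ≫ f) = 0 := by
    intro Z b
    rw [exists_factor_pushout_inl_iff, ← hp']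
    refine forall_congr' fun w => ?_
    rw [← Category.assoc b, hα', Category.assoc]
  have hfac : IsLeftFactoring I (pushout.inl a s) := by
    intro Z u hu
    rw [exists_factor_pushout_inl_iff, hs]
    intro w
    have h1 := hξ (u ≫ w) (hI.postcomp hu w)
    rwa [ha, Category.assoc, ← Category.assoc a] at h1
  obtain ⟨ψ, hψ, rfl⟩ := h _ hfac φ hφ
  -- Strong factorization is needed here: `ψ` lies in `I`, so its restriction along the other leg
  -- factors through `f` as `g ≫ f`. Hence `ξ φ = τ (s ≫ g ≫ f) = 0`.
  obtain ⟨g, hg⟩ := hf (pushout.inr a s ≫ ψ) (hI.precomp _ hψ)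
  apply hξφ
  rw [ha, pushout.condition_assoc, ← hg]
  exact (hs s).1 ⟨𝟙 _, Category.comp_id _⟩ g

/-- For `ξ` killing `f ≫ I(M, Y)` but not `φ`, the functional `ξ (f ≫ -)` is `τ (c ≫ -)`. The
pushout of `p` along `c` is the morphism through which `u` factors iff `ξ (f ≫ u ≫ w) = 0` for all
`w`. It is left `I`-factoring, hence so is its composite with `f`, through which `φ` factors; this
gives `ξ φ = 0`. -/
lemma IsFpIdempotent.isLeftIdempotent [HasFiniteColimits C] (hE : IsCogenerator.{u, v} k E)
    (hC : HasFpDuals k E C) {I : MorphismProperty C} (hI : IsIdeal I) (h : IsFpIdempotent I) :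
    IsLeftIdempotent I := by
  intro X M f hf Y φ hφ
  by_contra hcon
  obtain ⟨ξ, hξI, hξφ⟩ := hE _
    ((hI.submodule k hφ M Y).map (Linear.leftComp k Y f)) φ (fun ⟨g, hg, e⟩ => hcon ⟨g, hg, e⟩)
  have hξ : ∀ g : M ⟶ Y, I g → ξ (f ≫ g) = 0 := fun g hg => hξI _ ⟨g, hg, rfl⟩
  obtain ⟨P, Q, p, τ, hτ, hp⟩ := hC Y
  obtain ⟨c, hc⟩ := hτ M (ξ ∘ₗ Linear.leftComp k Y f)
  have hc' : ∀ w : M ⟶ Y, ξ (f ≫ w) = τ (c ≫ w) := hc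
  have hs : ∀ {Z : C} (u : M ⟶ Z), (∃ v, pushout.inl c p ≫ v = u) ↔
      ∀ w : Z ⟶ Y, ξ (f ≫ u ≫ w) = 0 := by
    intro Z u
    rw [exists_factor_pushout_inl_iff, ← hp]
    refine forall_congr' fun w => ?_
    rw [hc', Category.assoc]
  have hfac : IsLeftFactoring I (pushout.inl c p) := fun Z u hu =>
    (hs u).2 fun w => hξ _ (hI.postcomp hu w)
  obtain ⟨v, rfl⟩ := h.isLeftFactoring_comp hI hf hfac φ hφ
  apply hξφ
  rw [Category.assoc]
  exact (hs _).1 ⟨𝟙 _, Category.comp_id _⟩ v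

end Duality

/-! ### Application to finitely generated modules -/

section FGModules

open scoped ModuleCat.Algebra

variable {k : Type u} [CommRing k] {E : Type u} [AddCommGroup E] [Module k E]
  {A : Type u} [Ring A] [Algebra k A]

/-- Morphisms of `FGModuleCat A` are `A`-linear maps, compatibly with the action of `k`. -/
def homEquivLinearMap (k : Type u) [CommRing k] {A : Type u} [Ring A] [Algebra k A]
    (X Y : FGModuleCat.{u} A) : (X ⟶ Y) ≃ₗ[k] (X →ₗ[A] Y) where
  toFun f := f.hom.hom
  invFun f := ObjectProperty.homMk (ModuleCat.ofHom f)
  map_add' _ _ := rfl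
  map_smul' _ _ := rfl

lemma IsDualizing.isCogenerator (hE : IsDualizing k E) : IsCogenerator.{u, v} k E :=
  fun _ _ _ N _ hx => hE.exists_apply_ne_zero_of_notMem N hx

variable [IsArtinianRing k] [Module.Finite k A]

lemma IsDualizing.hasFpDuals (hE : IsDualizing k E) : HasFpDuals k E (FGModuleCat.{u} A) := by
  intro Y
  have : Module.Finite k Y := Module.Finite.trans A Y
  obtain ⟨n, m, p, τ, hτ, hp⟩ := hE.exists_presentation_dual_hom_to (A := A) Y
  refine ⟨FGModuleCat.of A (Fin n → A), FGModuleCat.of A (Fin m → A), FGModuleCat.ofHom p,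
    τ ∘ₗ (homEquivLinearMap k _ Y).toLinearMap, fun Z ξ => ?_, fun Z a => ?_⟩
  · obtain ⟨a, ha⟩ := hτ Z (ξ ∘ₗ (homEquivLinearMap k Z Y).symm.toLinearMap)
    exact ⟨(homEquivLinearMap k (FGModuleCat.of A (Fin n → A)) Z).symm a,
      fun w => ha (homEquivLinearMap k Z Y w)⟩
  · refine Iff.trans ⟨fun h w => h ((homEquivLinearMap k Z Y).symm w), fun h w =>
      h (homEquivLinearMap k Z Y w)⟩ ((hp Z a.hom.hom).trans ⟨?_, ?_⟩)
    · rintro ⟨b, hb⟩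
      exact ⟨(homEquivLinearMap k (FGModuleCat.of A (Fin m → A)) Z).symm b,
        FGModuleCat.hom_ext hb⟩
    · rintro ⟨b, rfl⟩
      exact ⟨b.hom.hom, rfl⟩

lemma IsDualizing.hasFpDuals_op (hE : IsDualizing k E) :
    HasFpDuals k E (FGModuleCat.{u} A)ᵒᵖ := by
  have : IsNoetherianRing A := IsNoetherianRing.of_finite k A
  intro X
  obtain ⟨n, m, p, τ, hτ, hp⟩ := hE.exists_presentation_dual_hom_from (A := A) X.unop
  have hfin : ∀ n, Module.Finite A (FreeDual k A E n) := fun n => FreeDual.finite hE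
  let τ' : (op (FGModuleCat.of A (FreeDual k A E n)) ⟶ X) →ₗ[k] E :=
    { toFun f := τ f.unop.hom.hom
      map_add' f g := map_add τ f.unop.hom.hom g.unop.hom.hom
      map_smul' r f := by
        -- On morphisms `k` acts through `A`, while `τ` is linear for the pointwise action on
        -- functionals; the scalar tower identifies the two.
        refine (congrArg τ (LinearMap.ext fun x => ?_)).trans (map_smul τ r f.unop.hom.hom)
        exact algebraMap_smul A r (f.unop.hom.hom x) }
  refine ⟨op (FGModuleCat.of A (FreeDual k A E n)), op (FGModuleCat.of A (FreeDual k A E m)),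
    (FGModuleCat.ofHom p).op, τ', fun Z ξ => ?_, fun Z a => ?_⟩
  · let ξ' : (X.unop →ₗ[A] Z.unop) →ₗ[k] E :=
      { toFun w := ξ ((homEquivLinearMap k X.unop Z.unop).symm w).op
        map_add' w w' := map_add ξ ((homEquivLinearMap k X.unop Z.unop).symm w).op
          ((homEquivLinearMap k X.unop Z.unop).symm w').op
        map_smul' r w := map_smul ξ r ((homEquivLinearMap k X.unop Z.unop).symm w).op }
    obtain ⟨a, ha⟩ := hτ Z.unop ξ'
    exact ⟨((homEquivLinearMap k Z.unop (FGModuleCat.of A (FreeDual k A E n))).symm a).op,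
      fun w => ha w.unop.hom.hom⟩
  · refine Iff.trans ⟨fun h w => h ((homEquivLinearMap k X.unop Z.unop).symm w).op, fun h w =>
      h w.unop.hom.hom⟩ ((hp Z.unop a.unop.hom.hom).trans ⟨?_, ?_⟩)
    · rintro ⟨b, hb⟩
      exact ⟨((homEquivLinearMap k Z.unop (FGModuleCat.of A (FreeDual k A E m))).symm b).op,
        Quiver.Hom.unop_inj (FGModuleCat.hom_ext hb)⟩
    · rintro ⟨b, rfl⟩
      exact ⟨b.unop.hom.hom, rfl⟩

end FGModules

end FpIdempotent

theorem lemma5p1 (k : Type u) {A : Type u} [CommRing k] [IsArtinianRing k] [Ring A]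
    [Algebra k A] [Module.Finite k A] (I : MorphismProperty (FGModuleCat.{u} A))
    (hI : FpIdempotent.IsIdeal I) :
    (FpIdempotent.IsFpIdempotent I ↔ FpIdempotent.IsLeftIdempotent I) ∧
      (FpIdempotent.IsLeftIdempotent I ↔ FpIdempotent.IsRightIdempotent I) := by
  have : IsNoetherianRing A := IsNoetherianRing.of_finite k A
  let _ : Linear k (ModuleCat.{u} A) := ModuleCat.Algebra.instLinear
  obtain ⟨E, _, _, hE⟩ := FpIdempotent.exists_isDualizing k
  refine ⟨⟨fun h => h.isLeftIdempotent hE.isCogenerator hE.hasFpDuals hI,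
    fun h => h.isFpIdempotent hI⟩, fun h => h.isRightIdempotent hE.isCogenerator hE.hasFpDuals hI,
    fun h => ?_⟩
  -- Left and right are exchanged in the opposite category, so the implication already proved
  -- applies to `I.op`.
  rw [← FpIdempotent.isRightIdempotent_op_iff]
  rw [← FpIdempotent.isLeftIdempotent_op_iff] at h
  exact h.isRightIdempotent hE.isCogenerator hE.hasFpDuals_op hI.op
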